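/- **Setting.** Let $a_1,a_2,a_3>0$, $F>0$, $\nu,\nu'>0$, and let $\mathbb T^3=\prod_{i=1}^3\mathbb R/(2\pi a_i\mathbb Z)$. For $n\in\mathbb Z^3$ write $\check n_i=n_i/a_i$, $|\check n_h|^2=\check n_1^2+\check n_2^2$, $|\check n|_F^2=|\check n_h|^2+F^2\check n_3^2$, and $u=\sum_n\hat u_n e^{i\check n\cdot x}$. Put $$\|u\|_{H^{0,s}}^2=\sum_{n}(1+\check n_3^2)^s|\hat u_n|^2,\qquad \|\nabla_h u\|_{H^{0,s}}^2=\|\partial_1u\|_{H^{0,s}}^2+\|\partial_2u\|_{H^{0,s}}^2 .$$ Let $\Delta_F^{-1}$ be the Fourier multiplier with symbol $-|\check n|_F^{-2}$ and $a_{QG}(D_h)$ the Fourier multiplier with symbol $\dfrac{\nu|\check n_h|^2+\nu'F^2\check n_3^2}{|\check n|_F^2}\,|\check n_h|^2$ (both symbols are $0$ at $n=0$). Consider the potential vorticity equation $$\partial_t\Omega+v_{QG}^h\cdot\nabla_h\Omega+a_{QG}(D_h)\Omega=0,\qquad v_{QG}^h=(-\partial_2,\partial_1)\Delta_F^{-1}\Omega,\qquad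 \Omega|_{t=0}=\Omega_0 .\tag{1}$$ A real-valued $\Omega$ on $\mathbb R_+\times\mathbb T^3$ is called a solution of (1) if $\Omega\in L^\infty_{loc}(\mathbb R_+;L^2(\mathbb T^3))$, $\nabla_h\Omega\in L^2_{loc}(\mathbb R_+;L^2(\mathbb T^3))$, and (1) holds in the sense of distributions, with initial datum $\Omega_0$ and with $v_{QG}^h\cdot\nabla_h\Omega=\mathrm{div}_h(\Omega\, v_{QG}^h)$. **Proposition.** There is a constant $c>0$ depending only on $\nu,\nu'$ and, for every $a_1,a_2,a_3,F>0$ and every $s>0$, a constant $C>0$ (depending on $a_1,a_2,a_3,F,\nu,\nu',s$) such that the following holds. Let $\Omega_0\in H^{0,s}(\mathbb T^3)$ be real-valued, and let $\Omega$ be a solution of (1). Then, after modification on a null set of times, $\Omega\in\mathcal C(\mathbb R_+;H^{0,s})$ with $\Omega(0)=\Omega_0$, $\nabla_h\Omega\in L^2(\mathbb R_+;H^{0,s})$, and for all $t\ge 0$ $$\|\Omega(t)\|_{H^{0,s}}^2+c\int_0^t\|\nabla_h\Omega(\tau)\|_{H^{0,s}}^2\,d\tau\le C\,\|\Omega_0\|_{H^{0,s}}^2\exp\Big\{\frac{2C}{c}\big(1+\|\Omega_0\|_{L^2(\mathbb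 T^3)}^2\big)\|\Omega_0\|_{L^2(\mathbb T^3)}^2\Big\}.$$ -/

import Mathlib

open MeasureTheory Filter Topology
open scoped ENNReal

noncomputable section

namespace QG

/-- The torus `T³ = ∏ ℝ / (2π aᵢ ℤ)`, in the angular coordinates `θᵢ = xᵢ / (2π aᵢ) ∈ ℝ / ℤ`.
The lengths `aᵢ` enter through the frequencies `nᵢ / aᵢ`, the derivatives in `xᵢ` and the
volume. -/
abbrev Torus : Type := UnitAddTorus (Fin 3)

/-- The product Haar probability measure, that is `dx / |T³|` with `|T³| = ∏ 2π aᵢ`. -/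
abbrev torusMeasure : Measure Torus :=
  Measure.pi fun _ : Fin 3 => (AddCircle.haarAddCircle : Measure UnitAddCircle)

/-- Real valued square integrable functions on the torus. -/
abbrev L2 : Type := Lp ℝ 2 torusMeasure

/-- The square of the norm of `L²(T³, dx)`, where `dx` is the Lebesgue measure on
`∏ [0, 2π aᵢ)`. -/
def l2NormSq (a : Fin 3 → ℝ) (u : L2) : ℝ := (∏ i, 2 * Real.pi * a i) * ‖u‖ ^ 2

/-- The `n`-th Fourier coefficient: `u = ∑ ûₙ exp (i ň · x)`, with `ňᵢ = nᵢ / aᵢ`. Note that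
`exp (i ň · x) = exp (2 π i n · θ)`. -/
def coeff (u : Torus → ℝ) (n : Fin 3 → ℤ) : ℂ :=
  ∫ θ, UnitAddTorus.mFourier (-n) θ * (u θ : ℂ) ∂torusMeasure

/-- The frequency `ňᵢ = nᵢ / aᵢ`. -/
def freq (a : Fin 3 → ℝ) (n : Fin 3 → ℤ) (i : Fin 3) : ℝ := (n i : ℝ) / a i

/-- `|ň_h|² = ň₁² + ň₂²`. -/
def freqHSq (a : Fin 3 → ℝ) (n : Fin 3 → ℤ) : ℝ := freq a n 0 ^ 2 + freq a n 1 ^ 2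

/-- `|ň|_F² = ň₁² + ň₂² + F² ň₃²`, the Fourier symbol of `-Δ_F`. -/
def freqFSq (a : Fin 3 → ℝ) (F : ℝ) (n : Fin 3 → ℤ) : ℝ :=
  freqHSq a n + F ^ 2 * freq a n 2 ^ 2

/-- The square of the anisotropic Sobolev norm `H^{r,s}` of the distribution with Fourier
coefficients `c` (infinite when it does not belong to the space). -/
def sobolevSq (a : Fin 3 → ℝ) (r s : ℝ) (c : (Fin 3 → ℤ) → ℂ) : ℝ≥0∞ :=
  ∑' n, ENNReal.ofReal
    ((1 + freqHSq a n) ^ r * (1 + freq a n 2 ^ 2) ^ s * ‖c n‖ ^ 2)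

/-- `‖u‖²` in `H^{0,s}`. -/
def normSq (a : Fin 3 → ℝ) (s : ℝ) (u : L2) : ℝ≥0∞ := sobolevSq a 0 s (coeff u)

/-- `‖∇_h u‖²` in `H^{0,s}`: the (distributional) derivative `∂_j u` has the Fourier coefficients
`i ň_j ûₙ`. -/
def gradNormSq (a : Fin 3 → ℝ) (s : ℝ) (u : L2) : ℝ≥0∞ :=
  sobolevSq a 0 s (fun n => Complex.I * freq a n 0 * coeff u n) +
    sobolevSq a 0 s (fun n => Complex.I * freq a n 1 * coeff u n)

/-- The Fourier multiplier with symbol `m`, applied to a real function: the sum in `L²` of the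
Fourier series `∑ m(n) ûₙ exp (i ň · x)`. The real part only serves to have values in `ℝ`: it
changes nothing for a symbol with `m(-n) = conj m(n)`, as all those below. -/
def multiplier (m : (Fin 3 → ℤ) → ℂ) (u : Torus → ℝ) : Torus → ℝ := fun θ =>
  ((∑' n, (m n * coeff u n) •
      ContinuousMap.toLp (E := ℂ) 2 torusMeasure ℂ (UnitAddTorus.mFourier n) :
    Lp ℂ 2 torusMeasure) θ).re

/-- The symbol of `Δ_F⁻¹`; the value at `n = 0` is `0`. -/
def invLaplaceF (a : Fin 3 → ℝ) (F : ℝ) (n : Fin 3 → ℤ) : ℝ := -(1 / freqFSq a F n)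

/-- First component `-∂₂ Δ_F⁻¹ Ω` of the quasi-geostrophic velocity. -/
def velocity₁ (a : Fin 3 → ℝ) (F : ℝ) (Ω : L2) : Torus → ℝ :=
  multiplier (fun n => -(Complex.I * freq a n 1) * invLaplaceF a F n) Ω

/-- Second component `∂₁ Δ_F⁻¹ Ω` of the quasi-geostrophic velocity. -/
def velocity₂ (a : Fin 3 → ℝ) (F : ℝ) (Ω : L2) : Torus → ℝ :=
  multiplier (fun n => Complex.I * freq a n 0 * invLaplaceF a F n) Ω

/-- The symbol of `a_QG(D_h)`:
`(ν |ň_h|² + ν' F² ň₃²) / (|ň_h|² + F² ň₃²) * |ň_h|²`, and `0` at `n = 0`. -/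
def symbolQG (a : Fin 3 → ℝ) (F ν ν' : ℝ) (n : Fin 3 → ℤ) : ℝ :=
  (ν * freqHSq a n + ν' * F ^ 2 * freq a n 2 ^ 2) / freqFSq a F n * freqHSq a n

/-- The derivative `∂f/∂xᵢ`; a displacement `h` in `xᵢ` is `h / (2π aᵢ)` in `θᵢ`. -/
def pderiv (a : Fin 3 → ℝ) (i : Fin 3) (f : Torus → ℝ) (θ : Torus) : ℝ :=
  deriv (fun h : ℝ => f (θ + Pi.single i ((h / (2 * Real.pi * a i) : ℝ) : UnitAddCircle))) 0

/-- Test functions on `[0, ∞) × T³`: smooth on `ℝ × T³`, and vanishing for large times. -/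
structure IsTestFunction (φ : ℝ → Torus → ℝ) : Prop where
  smooth : ContDiff ℝ ((⊤ : ℕ∞) : WithTop ℕ∞)
    fun p : ℝ × (Fin 3 → ℝ) => φ p.1 (fun i => ((p.2 i : ℝ) : UnitAddCircle))
  support : ∃ T : ℝ, ∀ t, T ≤ t → ∀ θ, φ t θ = 0

/-- `Ω` is a weak solution, in the energy space, of
`∂ₜΩ + v^h · ∇_h Ω + a_QG(D_h) Ω = 0`, `v^h = (-∂₂, ∂₁) Δ_F⁻¹ Ω`, `Ω(0) = Ω₀`:
`Ω ∈ L^∞_loc(ℝ₊; L²)`, `∇_h Ω ∈ L²_loc(ℝ₊; L²)`, and the equation, with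
`v^h · ∇_h Ω = div_h (Ω v^h)`, holds in the sense of distributions. -/
structure IsWeakSolution (a : Fin 3 → ℝ) (F ν ν' : ℝ) (Ω₀ : L2) (Ω : ℝ → L2) : Prop where
  measurable : AEStronglyMeasurable Ω (volume.restrict (Set.Ici 0))
  bounded : ∀ T : ℝ, ∃ M : ℝ, ∀ᵐ t ∂(volume.restrict (Set.Icc 0 T)), ‖Ω t‖ ≤ M
  gradient : ∀ T : ℝ, ∫⁻ t in Set.Icc 0 T, gradNormSq a 0 (Ω t) < ⊤
  equation : ∀ φ : ℝ → Torus → ℝ, IsTestFunction φ →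
    (∫ t in Set.Ici (0 : ℝ), ∫ θ,
      Ω t θ * (deriv (fun τ => φ τ θ) t
        + velocity₁ a F (Ω t) θ * pderiv a 0 (φ t) θ
        + velocity₂ a F (Ω t) θ * pderiv a 1 (φ t) θ
        - multiplier (fun n => symbolQG a F ν ν' n) (φ t) θ) ∂torusMeasure)
      + ∫ θ, Ω₀ θ * φ 0 θ ∂torusMeasure = 0

/-- `u ∈ C(ℝ₊; H^{0,s})`. -/
def ContinuousInH (a : Fin 3 → ℝ) (s : ℝ) (u : ℝ → L2) : Prop :=
  (∀ t, 0 ≤ t → normSq a s (u t) < ⊤) ∧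
    ∀ t₀, 0 ≤ t₀ → Tendsto (fun t => normSq a s (u t - u t₀)) (𝓝[Set.Ici 0] t₀) (𝓝 0)

end QG

end

/-!
# Propagation of the anisotropic regularity `H^{0,s}` for the potential vorticity equation

In Fourier variables the equation is `xₙ' = -σₙ xₙ - Nₙ(x)`, where `σ` is the symbol of `a_QG(D_h)`
and `Nₙ(x) = ∑ₖ κ(n, k) xₖ xₙ₋ₖ` with `κ(n, k) = (ň_h^⊥ · ǩ_h) / |ǩ|_F²`. Testing the weak
formulation with `χ(t) Re (z exp (-i ň · x))` shows that the Fourier coefficients of a weak solution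
agree at almost all times with continuous functions `xₙ` that solve these equations in integrated
form (`IsWeakSolution.exists_modeSolution`). The function with coefficients `x(t)` is the required
modification, and everything else is proved for `x`.

The kernel `κ(n, k)` vanishes when `n - k` has no horizontal part, and it is at most
`|ň_h| |ǩ_h| / |ǩ|_F²`. So the nonlinear term is controlled by the product of the velocity and of
the part of `Ω` without horizontal mean. The main estimate (`exists_convMajorant_bound`) bounds this
product in a weighted `ℓ²` space, for a weight `λ` with `λ(n) ≤ C (λ(k) + λ(n - k))`, by
`‖λ Ω‖ ‖∇_h Ω‖`. If the weight falls on `Ω`, it follows from `‖v‖_{L^∞} ≲ ‖∇_h Ω‖_{L²}`, that is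
from the convergence of `∑ |k|_F^{-4}` over `ℤ³`. If it falls on the velocity, the
Cauchy–Schwarz inequality reduces it to a bound, uniform in `n`, for
`∑ₖ |ǩ_h|² |ǩ|_F^{-4} |ň_h - ǩ_h|^{-2}`.

In `L²` the nonlinear term disappears, because `κ` is skew-symmetric under
`(n, k) ↦ (n - k, -k)`; the series converges absolutely in the energy class, so every weak solution
satisfies the energy inequality (`IsModeSolution.energy_le`), and
`2 min(ν, ν') ∫ ‖∇_h Ω‖² ≤ ‖Ω₀‖²`. With a weight no cancellation is needed: the main estimate and
the dissipation give `E' + min(ν, ν') ‖λ ∇_h Ω‖² ≲ ‖∇_h Ω‖² E` for `E = ‖λ Ω‖²`, and Grönwall's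
inequality applies. This is legitimate for bounded weights, for which all terms are finite for
functions in the energy class, and the truncations `min(λ, N)` of `λ = (1 + ň₃²)^{s/2}` satisfy the
hypothesis on `λ` with the same constant (`exists_weight_bound`).

For continuity in `H^{0,s}`, the energy inequality of each mode bounds `|xₙ(t)|²`, locally uniformly
in time, by the terms of a convergent weighted series, and each `xₙ` is continuous; dominated
convergence concludes (`IsModeSolution.tendsto_weighted`).
-/

namespace QG

/-! ### Fourier series of real square integrable functions -/

/-- The Fourier basis of the complex space `L²(T³)`, for the measure of the statement. -/
noncomputable def fourierBasis : HilbertBasis (Fin 3 → ℤ) ℂ (Lp ℂ 2 torusMeasure) :=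
  UnitAddTorus.mFourierBasis

theorem fourierBasis_repr (f : Lp ℂ 2 torusMeasure) (n : Fin 3 → ℤ) :
    fourierBasis.repr f n = ∫ θ, UnitAddTorus.mFourier (-n) θ * f θ ∂torusMeasure :=
  UnitAddTorus.mFourierBasis_repr f n

theorem fourierBasis_apply (n : Fin 3 → ℤ) :
    fourierBasis n =
      ContinuousMap.toLp (E := ℂ) 2 torusMeasure ℂ (UnitAddTorus.mFourier n) := by
  unfold fourierBasis
  rw [UnitAddTorus.coe_mFourierBasis]
  rfl

/-- A real function of `L²(T³)`, seen as a complex one. -/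
noncomputable def complexify : L2 →L[ℝ] Lp ℂ 2 torusMeasure :=
  Complex.ofRealCLM.compLpL 2 torusMeasure

theorem coeFn_complexify (u : L2) : complexify u =ᵐ[torusMeasure] fun θ => (u θ : ℂ) :=
  Complex.ofRealCLM.coeFn_compLpL u

theorem norm_mFourier_apply_le (n : Fin 3 → ℤ) (θ : Torus) :
    ‖UnitAddTorus.mFourier n θ‖ ≤ 1 :=
  (ContinuousMap.norm_coe_le_norm _ θ).trans UnitAddTorus.mFourier_norm.le

theorem coeff_congr {u v : Torus → ℝ} (h : u =ᵐ[torusMeasure] v) : coeff u = coeff v := by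
  funext n
  apply integral_congr_ae
  filter_upwards [h] with θ hθ
  rw [hθ]

theorem coeff_eq_repr (u : L2) (n : Fin 3 → ℤ) :
    coeff u n = fourierBasis.repr (complexify u) n := by
  rw [fourierBasis_repr]
  apply integral_congr_ae
  filter_upwards [coeFn_complexify u] with θ hθ
  rw [hθ]

theorem coeff_neg (u : Torus → ℝ) (n : Fin 3 → ℤ) :
    coeff u (-n) = starRingEnd ℂ (coeff u n) := by
  rw [coeff, coeff, ← integral_conj]
  congr 1
  funext θ
  rw [UnitAddTorus.mFourier_neg, map_mul, Complex.conj_ofReal]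

theorem complexify_injective : Function.Injective complexify := by
  intro u v h
  apply Lp.ext
  filter_upwards [coeFn_complexify u, coeFn_complexify v] with θ h1 h2
  rw [h, h2] at h1
  exact_mod_cast h1.symm

theorem ext_coeff {u v : L2} (h : ∀ n, coeff u n = coeff v n) : u = v := by
  apply complexify_injective
  apply fourierBasis.repr.injective
  ext n
  rw [← coeff_eq_repr, ← coeff_eq_repr, h]

theorem norm_complexify (u : L2) : ‖complexify u‖ = ‖u‖ := by
  rw [Lp.norm_def, Lp.norm_def, eLpNorm_congr_ae (coeFn_complexify u)]
  congr 1
  apply eLpNorm_congr_norm_ae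
  filter_upwards with θ
  simp

/-- Parseval's identity. -/
theorem hasSum_sq_coeff (u : L2) : HasSum (fun n => ‖coeff u n‖ ^ 2) (‖u‖ ^ 2) := by
  have h := (fourierBasis.hasSum_inner_mul_inner (complexify u) (complexify u))
  have h2 := (RCLike.hasSum_re ℂ h)
  rw [inner_self_eq_norm_sq (𝕜 := ℂ), norm_complexify] at h2
  refine h2.congr_fun fun n => ?_
  rw [coeff_eq_repr, HilbertBasis.repr_apply_apply, ← inner_conj_symm (complexify u),
    RCLike.conj_mul, ← RCLike.ofReal_pow, RCLike.ofReal_re]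

theorem coeff_sub (u v : L2) (n : Fin 3 → ℤ) :
    coeff ((u - v : L2) : Torus → ℝ) n = coeff u n - coeff v n := by
  simp only [coeff_eq_repr, map_sub]
  rfl

theorem continuous_coeff (n : Fin 3 → ℤ) : Continuous fun u : L2 => coeff u n := by
  simp_rw [coeff_eq_repr, HilbertBasis.repr_apply_apply]
  exact continuous_const.inner complexify.continuous

/-- The real part of the sum of a Fourier series with coefficients `c`, when `c(-n) = conj c(n)`
and `c` is square summable, is a real function with Fourier coefficients `c`. -/
theorem exists_re_tsum {c : (Fin 3 → ℤ) → ℂ} (hs : Summable fun n => ‖c n‖ ^ 2)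
    (hc : ∀ n, c (-n) = starRingEnd ℂ (c n)) :
    ∃ u : L2, (∀ n, coeff u n = c n) ∧ u =ᵐ[torusMeasure] fun θ =>
      ((∑' n, c n • ContinuousMap.toLp (E := ℂ) 2 torusMeasure ℂ (UnitAddTorus.mFourier n) :
        Lp ℂ 2 torusMeasure) θ).re := by
  have hmem : Memℓp c 2 := by
    apply memℓp_gen
    simpa using hs
  set f : lp (fun _ : Fin 3 → ℤ => ℂ) 2 := ⟨c, hmem⟩ with hf
  have hsum := (fourierBasis.hasSum_repr_symm f).tsum_eq
  simp_rw [fourierBasis_apply] at hsum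
  set w : Lp ℂ 2 torusMeasure := fourierBasis.repr.symm f with hw
  have hwc : ∀ n, ∫ θ, UnitAddTorus.mFourier (-n) θ * w θ ∂torusMeasure = c n := by
    intro n
    rw [← fourierBasis_repr, hw, LinearIsometryEquiv.apply_symm_apply]
  have hint : ∀ n, Integrable (fun θ => UnitAddTorus.mFourier (-n) θ * w θ) torusMeasure := by
    intro n
    have h1 : MemLp (UnitAddTorus.mFourier (-n) : Torus → ℂ) 2 torusMeasure :=
      MemLp.of_bound (UnitAddTorus.mFourier (-n)).continuous.aestronglyMeasurable 1
        (Eventually.of_forall (norm_mFourier_apply_le (-n)))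
    exact (Lp.memLp w).integrable_mul h1 |>.congr (by filter_upwards with θ; simp [mul_comm])
  have hre : MemLp (fun θ => (w θ).re) 2 torusMeasure := (Lp.memLp w).re
  refine ⟨hre.toLp _, fun n => ?_, ?_⟩
  · rw [coeff_congr hre.coeFn_toLp]
    have h2 : (fun θ => UnitAddTorus.mFourier (-n) θ * (((w θ).re : ℝ) : ℂ)) =
        fun θ => (1 / 2 : ℂ) * (UnitAddTorus.mFourier (-n) θ * w θ +
          starRingEnd ℂ (UnitAddTorus.mFourier (-(-n)) θ * w θ)) := by
      funext θ
      rw [map_mul, ← UnitAddTorus.mFourier_neg, neg_neg, Complex.re_eq_add_conj]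
      ring
    rw [coeff, h2, integral_const_mul, integral_add (hint n), integral_conj, hwc, hwc, hc,
      Complex.conj_conj]
    · ring
    · exact (LinearIsometryEquiv.integrable_comp_iff Complex.conjLIE).mpr (hint (-n))
  · refine hre.coeFn_toLp.trans ?_
    rw [hsum]

/-- A multiplier with `m(-n) = conj m(n)` acts as expected on Fourier coefficients. -/
theorem exists_multiplier {m : (Fin 3 → ℤ) → ℂ} (hm : ∀ n, m (-n) = starRingEnd ℂ (m n))
    {u : Torus → ℝ} (hs : Summable fun n => ‖m n * coeff u n‖ ^ 2) :
    ∃ w : L2, (∀ n, coeff w n = m n * coeff u n) ∧ multiplier m u =ᵐ[torusMeasure] w := by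
  obtain ⟨w, h1, h2⟩ := exists_re_tsum hs (fun n => by rw [hm, coeff_neg, map_mul])
  exact ⟨w, h1, h2.symm⟩

/-- The Fourier coefficients of a product of two square integrable functions. -/
theorem hasSum_coeff_mul (w u : L2) (n : Fin 3 → ℤ) :
    HasSum (fun k => coeff w k * coeff u (n - k)) (coeff (fun θ => w θ * u θ) n) := by
  have hmem : MemLp (fun θ => UnitAddTorus.mFourier n θ * (w θ : ℂ)) 2 torusMeasure := by
    have h1 : MemLp (fun θ => (w θ : ℂ)) 2 torusMeasure := (Lp.memLp w).ofReal
    refine h1.of_le ((UnitAddTorus.mFourier n).continuous.aestronglyMeasurable.mul h1.1) ?_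
    filter_upwards with θ
    rw [norm_mul]
    exact mul_le_of_le_one_left (norm_nonneg _) (norm_mFourier_apply_le n θ)
  have h := fourierBasis.hasSum_inner_mul_inner (hmem.toLp _) (complexify u)
  have e1 : inner ℂ (hmem.toLp _) (complexify u) = coeff (fun θ => w θ * u θ) n := by
    rw [MeasureTheory.L2.inner_def, coeff]
    apply integral_congr_ae
    filter_upwards [hmem.coeFn_toLp, coeFn_complexify u] with θ h1 h2
    rw [h1, h2, RCLike.inner_apply, map_mul, ← UnitAddTorus.mFourier_neg, Complex.conj_ofReal]
    push_cast
    ring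
  rw [e1] at h
  refine ((Equiv.subLeft n).hasSum_iff.mpr h).congr_fun fun k => ?_
  simp only [Function.comp, Equiv.subLeft_apply]
  rw [← HilbertBasis.repr_apply_apply, ← coeff_eq_repr]
  congr 1
  rw [MeasureTheory.L2.inner_def, coeff]
  apply integral_congr_ae
  filter_upwards [hmem.coeFn_toLp, ContinuousMap.coeFn_toLp (p := 2) (𝕜 := ℂ) torusMeasure
    (UnitAddTorus.mFourier (n - k) : C(Torus, ℂ))] with θ h1 h2
  have h3 : fourierBasis (n - k) θ = UnitAddTorus.mFourier (n - k) θ := by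
    rw [fourierBasis_apply, h2]
  rw [h1, h3, RCLike.inner_apply, map_mul, ← UnitAddTorus.mFourier_neg, Complex.conj_ofReal,
    ← mul_assoc, ← UnitAddTorus.mFourier_add]
  congr 3
  abel

/-! ### Convergent lattice sums -/

/-- The quartic root `(1 + |m|)^{1/4}`: all the lattice sums below are compared with
`∑ (1 + |m|)^{-5/4}` in each variable, and quartic roots keep the exponents integral. -/
noncomputable def quarticRoot (m : ℤ) : ℝ := (1 + |(m : ℝ)|) ^ (1 / 4 : ℝ)

theorem one_le_quarticRoot (m : ℤ) : 1 ≤ quarticRoot m :=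
  Real.one_le_rpow (by linarith [abs_nonneg (m : ℝ)]) (by norm_num)

theorem summable_inv_quarticRoot_pow : Summable fun m : ℤ => (quarticRoot m ^ 5)⁻¹ := by
  have h := Real.summable_abs_int_rpow (b := 5 / 4) (by norm_num)
  refine Summable.of_norm_bounded_eventually h ?_
  filter_upwards [(Set.finite_singleton (0 : ℤ)).compl_mem_cofinite] with m hm
  have hm0 : m ≠ 0 := by simpa using hm
  have h0 : 0 < |(m : ℝ)| := abs_pos.mpr (by exact_mod_cast hm0)
  have h1 : (quarticRoot m ^ 5)⁻¹ = (1 + |(m : ℝ)|) ^ (-(5 / 4 : ℝ)) := by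
    rw [quarticRoot, ← Real.rpow_natCast, ← Real.rpow_mul (by positivity),
      ← Real.rpow_neg (by positivity)]
    norm_num
  rw [Real.norm_of_nonneg (by rw [h1]; positivity), h1]
  exact Real.rpow_le_rpow_of_nonpos h0 (by linarith) (by norm_num)

/-- The summable weight `∏ (1 + |nᵢ|)^{-5/4}` on `ℤ³`. -/
noncomputable def latticeWeight (n : Fin 3 → ℤ) : ℝ :=
  (quarticRoot (n 0) ^ 5)⁻¹ * ((quarticRoot (n 1) ^ 5)⁻¹ * (quarticRoot (n 2) ^ 5)⁻¹)

theorem latticeWeight_nonneg (n : Fin 3 → ℤ) : 0 ≤ latticeWeight n := by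
  have := one_le_quarticRoot (n 0)
  have := one_le_quarticRoot (n 1)
  have := one_le_quarticRoot (n 2)
  unfold latticeWeight
  positivity

theorem summable_latticeWeight : Summable latticeWeight := by
  have h := summable_inv_quarticRoot_pow
  have hn : 0 ≤ fun m : ℤ => (quarticRoot m ^ 5)⁻¹ := fun m => by
    have := one_le_quarticRoot m
    positivity
  have h2 := h.mul_of_nonneg h hn hn
  have h3 := h.mul_of_nonneg h2 hn (fun p => mul_nonneg (hn _) (hn _))
  let e : (Fin 3 → ℤ) ≃ ℤ × ℤ × ℤ :=
    { toFun := fun n => (n 0, n 1, n 2)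
      invFun := fun p => ![p.1, p.2.1, p.2.2]
      left_inv := fun n => by ext i; fin_cases i <;> rfl
      right_inv := fun p => rfl }
  exact e.summable_iff.mpr h3

/-- Symmetry of the lattice weight under a reflection of the horizontal variables. -/
theorem tsum_latticeWeight_reflect (n : Fin 3 → ℤ) :
    ∑' k : Fin 3 → ℤ, ENNReal.ofReal (latticeWeight ![n 0 - k 0, n 1 - k 1, k 2]) =
      ∑' k, ENNReal.ofReal (latticeWeight k) := by
  let e : (Fin 3 → ℤ) ≃ (Fin 3 → ℤ) :=
    { toFun := fun k => ![n 0 - k 0, n 1 - k 1, k 2]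
      invFun := fun k => ![n 0 - k 0, n 1 - k 1, k 2]
      left_inv := fun k => by ext i; fin_cases i <;> simp
      right_inv := fun k => by ext i; fin_cases i <;> simp }
  exact e.tsum_eq fun k => ENNReal.ofReal (latticeWeight k)

theorem freqHSq_nonneg (a : Fin 3 → ℝ) (n : Fin 3 → ℤ) : 0 ≤ freqHSq a n := by
  unfold freqHSq; positivity

theorem freqFSq_nonneg (a : Fin 3 → ℝ) (F : ℝ) (n : Fin 3 → ℤ) : 0 ≤ freqFSq a F n := by
  have := freqHSq_nonneg a n
  unfold freqFSq; positivity

/-- The symbols are comparable to those of the torus `(ℝ / 2πℤ)³` and of `F = 1`. -/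
theorem exists_freq_bounds {a : Fin 3 → ℝ} (ha : ∀ i, 0 < a i) {F : ℝ} (hF : 0 < F) :
    ∃ m M : ℝ, 0 < m ∧ 0 < M ∧ ∀ n : Fin 3 → ℤ,
      m * ((n 0 : ℝ) ^ 2 + (n 1 : ℝ) ^ 2) ≤ freqHSq a n ∧
      freqHSq a n ≤ M * ((n 0 : ℝ) ^ 2 + (n 1 : ℝ) ^ 2) ∧
      m * ((n 0 : ℝ) ^ 2 + (n 1 : ℝ) ^ 2 + (n 2 : ℝ) ^ 2) ≤ freqFSq a F n := by
  have h0 := ha 0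
  have h1 := ha 1
  have h2 := ha 2
  refine ⟨min ((a 0 ^ 2)⁻¹) (min ((a 1 ^ 2)⁻¹) (F ^ 2 * (a 2 ^ 2)⁻¹)),
    max ((a 0 ^ 2)⁻¹) ((a 1 ^ 2)⁻¹), by positivity, by positivity, fun n => ?_⟩
  set m := min ((a 0 ^ 2)⁻¹) (min ((a 1 ^ 2)⁻¹) (F ^ 2 * (a 2 ^ 2)⁻¹))
  have m0 : m ≤ (a 0 ^ 2)⁻¹ := min_le_left _ _
  have m1 : m ≤ (a 1 ^ 2)⁻¹ := (min_le_right _ _).trans (min_le_left _ _)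
  have m2 : m ≤ F ^ 2 * (a 2 ^ 2)⁻¹ := (min_le_right _ _).trans (min_le_right _ _)
  have M0 := le_max_left ((a 0 ^ 2)⁻¹) ((a 1 ^ 2)⁻¹)
  have M1 := le_max_right ((a 0 ^ 2)⁻¹) ((a 1 ^ 2)⁻¹)
  have e : freqHSq a n = (a 0 ^ 2)⁻¹ * (n 0 : ℝ) ^ 2 + (a 1 ^ 2)⁻¹ * (n 1 : ℝ) ^ 2 := by
    simp only [freqHSq, freq, div_pow]; ring
  have e2 : freqFSq a F n = freqHSq a n + F ^ 2 * (a 2 ^ 2)⁻¹ * (n 2 : ℝ) ^ 2 := by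
    simp only [freqFSq, freq, div_pow]; ring
  have s0 := sq_nonneg (n 0 : ℝ)
  have s1 := sq_nonneg (n 1 : ℝ)
  have s2 := sq_nonneg (n 2 : ℝ)
  refine ⟨?_, ?_, ?_⟩
  · rw [e, mul_add]; gcongr
  · rw [e, mul_add]; gcongr
  · rw [e2, e, mul_add, mul_add]; gcongr

theorem freqHSq_eq_zero_iff {a : Fin 3 → ℝ} (ha : ∀ i, 0 < a i) (n : Fin 3 → ℤ) :
    freqHSq a n = 0 ↔ n 0 = 0 ∧ n 1 = 0 := by
  have h0 := (ha 0).ne'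
  have h1 := (ha 1).ne'
  rw [freqHSq, add_eq_zero_iff_of_nonneg (sq_nonneg _) (sq_nonneg _)]
  simp [freq, h0, h1]

theorem freqFSq_pos {a : Fin 3 → ℝ} (ha : ∀ i, 0 < a i) {F : ℝ} (hF : 0 < F)
    {n : Fin 3 → ℤ} (hn : n ≠ 0) : 0 < freqFSq a F n := by
  refine (freqFSq_nonneg a F n).lt_of_ne' fun h => hn ?_
  rw [freqFSq, add_eq_zero_iff_of_nonneg (freqHSq_nonneg a n) (by positivity)] at h
  obtain ⟨h0, h1⟩ := (freqHSq_eq_zero_iff ha n).mp h.1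
  have h2 : n 2 = 0 := by
    have := h.2
    simpa [freq, (ha 2).ne', hF.ne'] using this
  ext i; fin_cases i <;> simp [h0, h1, h2]

/-- `(2R)^{1/4}` for `R² = x` dominates the quartic roots of the integers of size at most `R`. -/
theorem exists_quarticRoot_bound {x : ℝ} (hx : 1 ≤ x) :
    ∃ τ : ℝ, 1 ≤ τ ∧ τ ^ 8 = 4 * x ∧ ∀ m : ℤ, (m : ℝ) ^ 2 ≤ x → quarticRoot m ≤ τ := by
  have hs : 1 ≤ √x := Real.one_le_sqrt.mpr hx
  refine ⟨(2 * √x) ^ (1 / 4 : ℝ), Real.one_le_rpow (by linarith) (by norm_num), ?_, ?_⟩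
  · rw [← Real.rpow_natCast, ← Real.rpow_mul (by positivity)]
    norm_num
    rw [mul_pow, Real.sq_sqrt (by linarith)]
    norm_num
  · intro m hm
    have h1 : |(m : ℝ)| ≤ √x := Real.abs_le_sqrt hm
    exact Real.rpow_le_rpow (by positivity) (by linarith) (by norm_num)

theorem one_le_sq_add_sq {p q : ℤ} (h : ¬ (p = 0 ∧ q = 0)) : 1 ≤ (p : ℝ) ^ 2 + (q : ℝ) ^ 2 := by
  have : 1 ≤ p ^ 2 + q ^ 2 := by
    by_contra hlt
    have hp : p ^ 2 = 0 := by nlinarith [sq_nonneg p, sq_nonneg q]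
    have hq : q ^ 2 = 0 := by nlinarith [sq_nonneg p, sq_nonneg q]
    exact h ⟨pow_eq_zero_iff two_ne_zero |>.mp hp, pow_eq_zero_iff two_ne_zero |>.mp hq⟩
  exact_mod_cast this

/-- `|k|_F^{-4}` is summable on `ℤ³`. -/
theorem exists_inv_freqFSq_sq_le {a : Fin 3 → ℝ} (ha : ∀ i, 0 < a i) {F : ℝ} (hF : 0 < F) :
    ∃ K : ℝ, 0 < K ∧ ∀ k : Fin 3 → ℤ, ((freqFSq a F k)⁻¹) ^ 2 ≤ K * latticeWeight k := by
  obtain ⟨m, M, hm, hM, hb⟩ := exists_freq_bounds ha hF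
  refine ⟨16 / m ^ 2, by positivity, fun k => ?_⟩
  by_cases hk : k = 0
  · subst hk
    have := latticeWeight_nonneg 0
    simp only [freqFSq, freqHSq, freq]
    simp
    positivity
  have hx : 1 ≤ (k 0 : ℝ) ^ 2 + (k 1 : ℝ) ^ 2 + (k 2 : ℝ) ^ 2 := by
    by_cases h : k 0 = 0 ∧ k 1 = 0
    · have h2 : k 2 ≠ 0 := fun h2 => hk (by ext i; fin_cases i <;> simp [h.1, h.2, h2])
      have := one_le_sq_add_sq (p := k 2) (q := 0) (fun h => h2 h.1)
      simp only [Int.cast_zero] at this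
      nlinarith [sq_nonneg (k 0 : ℝ), sq_nonneg (k 1 : ℝ)]
    · nlinarith [one_le_sq_add_sq h, sq_nonneg (k 2 : ℝ)]
  obtain ⟨τ, hτ, hτ8, hτb⟩ := exists_quarticRoot_bound hx
  have b0 := hτb (k 0) (by nlinarith [sq_nonneg (k 1 : ℝ), sq_nonneg (k 2 : ℝ)])
  have b1 := hτb (k 1) (by nlinarith [sq_nonneg (k 0 : ℝ), sq_nonneg (k 2 : ℝ)])
  have b2 := hτb (k 2) (by nlinarith [sq_nonneg (k 1 : ℝ), sq_nonneg (k 0 : ℝ)])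
  have r0 := one_le_quarticRoot (k 0)
  have r1 := one_le_quarticRoot (k 1)
  have r2 := one_le_quarticRoot (k 2)
  set x := (k 0 : ℝ) ^ 2 + (k 1 : ℝ) ^ 2 + (k 2 : ℝ) ^ 2
  have hw : (16 * x ^ 2)⁻¹ ≤ latticeWeight k := by
    rw [latticeWeight, ← mul_inv, ← mul_inv]
    apply inv_anti₀ (by positivity)
    calc quarticRoot (k 0) ^ 5 * (quarticRoot (k 1) ^ 5 * quarticRoot (k 2) ^ 5)
        ≤ τ ^ 5 * (τ ^ 5 * τ ^ 5) := by gcongr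
      _ = τ ^ 15 := by ring
      _ ≤ τ ^ 16 := pow_le_pow_right₀ hτ (by norm_num)
      _ = (τ ^ 8) ^ 2 := by ring
      _ = 16 * x ^ 2 := by rw [hτ8]; ring
  calc ((freqFSq a F k)⁻¹) ^ 2 ≤ ((m * x)⁻¹) ^ 2 := by
        have := freqFSq_nonneg a F k
        gcongr
        exact (hb k).2.2
    _ = 16 / m ^ 2 * (16 * x ^ 2)⁻¹ := by field_simp
    _ ≤ _ := by gcongr

/-- The weight behind the product law `L^∞_v H^{1/2}_h × L²_v H^1_h → L²`. With `α`, `β` and `τ`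
the quartic roots attached to `k_h`, `n_h - k_h` and `k`, the left side is of order
`α⁸ / (τ¹⁶ β⁸)`; the decay in `k₃` takes `τ⁵`, and `α⁻³ β⁻⁸` is at most `α⁻¹⁰ + β⁻¹⁰`. -/
theorem exists_kernel_weight_le {a : Fin 3 → ℝ} (ha : ∀ i, 0 < a i) {F : ℝ} (hF : 0 < F) :
    ∃ K : ℝ, 0 < K ∧ ∀ n k : Fin 3 → ℤ,
      freqHSq a k * ((freqFSq a F k)⁻¹) ^ 2 * (freqHSq a (n - k))⁻¹ ≤
        K * (latticeWeight k + latticeWeight ![n 0 - k 0, n 1 - k 1, k 2]) := by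
  obtain ⟨m, M, hm, hM, hb⟩ := exists_freq_bounds ha hF
  refine ⟨16 * M / m ^ 3, by positivity, fun n k => ?_⟩
  have w1 := latticeWeight_nonneg k
  have w2 := latticeWeight_nonneg ![n 0 - k 0, n 1 - k 1, k 2]
  by_cases hk : k 0 = 0 ∧ k 1 = 0
  · rw [(freqHSq_eq_zero_iff ha k).mpr hk, zero_mul, zero_mul]; positivity
  by_cases hl : (n - k) 0 = 0 ∧ (n - k) 1 = 0
  · rw [(freqHSq_eq_zero_iff ha (n - k)).mpr hl, inv_zero, mul_zero]; positivity
  have hx := one_le_sq_add_sq hk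
  have hy := one_le_sq_add_sq hl
  set x := (k 0 : ℝ) ^ 2 + (k 1 : ℝ) ^ 2 with hxdef
  set y := ((n - k) 0 : ℝ) ^ 2 + ((n - k) 1 : ℝ) ^ 2 with hydef
  set z := x + (k 2 : ℝ) ^ 2 with hzdef
  have hz : 1 ≤ z := by nlinarith [sq_nonneg (k 2 : ℝ)]
  obtain ⟨α, hα, hα8, hαb⟩ := exists_quarticRoot_bound hx
  obtain ⟨β, hβ, hβ8, hβb⟩ := exists_quarticRoot_bound hy
  obtain ⟨τ, hτ, hτ8, hτb⟩ := exists_quarticRoot_bound hz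
  have bk0 := hαb (k 0) (by nlinarith [sq_nonneg (k 1 : ℝ)])
  have bk1 := hαb (k 1) (by nlinarith [sq_nonneg (k 0 : ℝ)])
  have bl0 := hβb ((n - k) 0) (by nlinarith [sq_nonneg ((n - k) 1 : ℝ)])
  have bl1 := hβb ((n - k) 1) (by nlinarith [sq_nonneg ((n - k) 0 : ℝ)])
  have bk2 := hτb (k 2) (by nlinarith)
  have r0 := one_le_quarticRoot (k 0)
  have r1 := one_le_quarticRoot (k 1)
  have r2 := one_le_quarticRoot (k 2)
  have s0 := one_le_quarticRoot ((n - k) 0)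
  have s1 := one_le_quarticRoot ((n - k) 1)
  have hατ : α ≤ τ := by
    refine le_of_pow_le_pow_left₀ (n := 8) (by norm_num) (by linarith) ?_
    rw [hα8, hτ8]; nlinarith [sq_nonneg (k 2 : ℝ)]
  have e1 : ((freqFSq a F k)⁻¹) ^ 2 ≤ ((m * z)⁻¹) ^ 2 := by
    have := freqFSq_nonneg a F k
    gcongr
    exact (hb k).2.2
  have e2 : (freqHSq a (n - k))⁻¹ ≤ (m * y)⁻¹ := by
    gcongr
    exact (hb (n - k)).1
  have e3 : x * ((z : ℝ)⁻¹) ^ 2 * y⁻¹ = 16 * (α ^ 8 / (τ ^ 16 * β ^ 8)) := by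
    have : τ ^ 16 = 16 * z ^ 2 := by
      calc τ ^ 16 = (τ ^ 8) ^ 2 := by ring
        _ = _ := by rw [hτ8]; ring
    rw [this, hα8, hβ8]; field_simp
  have e4 : α ^ 8 / (τ ^ 16 * β ^ 8) ≤ (quarticRoot (k 2) ^ 5)⁻¹ * ((α ^ 3 * β ^ 8)⁻¹) := by
    rw [← mul_inv, div_le_iff₀ (by positivity), inv_mul_eq_div, le_div_iff₀ (by positivity)]
    calc α ^ 8 * (quarticRoot (k 2) ^ 5 * (α ^ 3 * β ^ 8))
        ≤ α ^ 8 * (τ ^ 5 * (α ^ 3 * β ^ 8)) := by gcongr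
      _ = α ^ 11 * τ ^ 5 * β ^ 8 := by ring
      _ ≤ τ ^ 11 * τ ^ 5 * β ^ 8 := by gcongr
      _ = _ := by ring
  have e5 : (α ^ 3 * β ^ 8)⁻¹ ≤ (α ^ 10)⁻¹ + (β ^ 10)⁻¹ := by
    rcases le_total α β with h | h
    · have : (α ^ 3 * β ^ 8)⁻¹ ≤ (α ^ 10)⁻¹ := by
        apply inv_anti₀ (by positivity)
        calc α ^ 10 = α ^ 3 * α ^ 7 := by ring
          _ ≤ α ^ 3 * β ^ 7 := by gcongr
          _ ≤ α ^ 3 * β ^ 8 := by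
              gcongr
              norm_num
      linarith [inv_nonneg.mpr (show 0 ≤ β ^ 10 by positivity)]
    · have : (α ^ 3 * β ^ 8)⁻¹ ≤ (β ^ 10)⁻¹ := by
        apply inv_anti₀ (by positivity)
        calc β ^ 10 = β ^ 2 * β ^ 8 := by ring
          _ ≤ α ^ 2 * β ^ 8 := by gcongr
          _ ≤ α ^ 3 * β ^ 8 := by
              gcongr
              norm_num
      linarith [inv_nonneg.mpr (show 0 ≤ α ^ 10 by positivity)]
  have e6 : (quarticRoot (k 2) ^ 5)⁻¹ * (α ^ 10)⁻¹ ≤ latticeWeight k := by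
    rw [latticeWeight, ← mul_assoc, mul_comm, ← mul_inv (quarticRoot (k 0) ^ 5)]
    gcongr
    calc quarticRoot (k 0) ^ 5 * quarticRoot (k 1) ^ 5 ≤ α ^ 5 * α ^ 5 := by gcongr
      _ = α ^ 10 := by ring
  have e7 : (quarticRoot (k 2) ^ 5)⁻¹ * (β ^ 10)⁻¹ ≤
      latticeWeight ![n 0 - k 0, n 1 - k 1, k 2] := by
    change _ ≤ (quarticRoot ((n - k) 0) ^ 5)⁻¹ * ((quarticRoot ((n - k) 1) ^ 5)⁻¹ *
      (quarticRoot (k 2) ^ 5)⁻¹)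
    rw [← mul_assoc, mul_comm, ← mul_inv (quarticRoot ((n - k) 0) ^ 5)]
    gcongr
    calc quarticRoot ((n - k) 0) ^ 5 * quarticRoot ((n - k) 1) ^ 5 ≤ β ^ 5 * β ^ 5 := by gcongr
      _ = β ^ 10 := by ring
  calc freqHSq a k * ((freqFSq a F k)⁻¹) ^ 2 * (freqHSq a (n - k))⁻¹
      ≤ (M * x) * ((m * z)⁻¹) ^ 2 * (m * y)⁻¹ := by
        have := freqHSq_nonneg a (n - k)
        gcongr
        exact (hb k).2.1
    _ = M / m ^ 3 * (x * ((z : ℝ)⁻¹) ^ 2 * y⁻¹) := by field_simp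
    _ = 16 * M / m ^ 3 * (α ^ 8 / (τ ^ 16 * β ^ 8)) := by rw [e3]; ring
    _ ≤ 16 * M / m ^ 3 * ((quarticRoot (k 2) ^ 5)⁻¹ * ((α ^ 10)⁻¹ + (β ^ 10)⁻¹)) := by
        gcongr
        refine e4.trans ?_
        gcongr
    _ ≤ _ := by
        rw [mul_add (quarticRoot (k 2) ^ 5)⁻¹]
        gcongr

/-! ### Convolution estimates for the nonlinearity -/

/-- The Cauchy–Schwarz inequality for series in `[0, ∞]`. -/
theorem ennreal_tsum_mul_sq_le {ι : Type*} (u v : ι → ℝ≥0∞) :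
    (∑' i, u i * v i) ^ 2 ≤ (∑' i, u i ^ 2) * ∑' i, v i ^ 2 := by
  let _ : MeasurableSpace ι := ⊤
  have h := ENNReal.lintegral_mul_le_Lp_mul_Lq (Measure.count : Measure ι)
    Real.HolderConjugate.two_two (f := u) (g := v) measurable_from_top.aemeasurable
    measurable_from_top.aemeasurable
  simp only [lintegral_count, Pi.mul_apply] at h
  have h2 := pow_le_pow_left' h 2
  rw [mul_pow, ← ENNReal.rpow_natCast, ← ENNReal.rpow_natCast, ← ENNReal.rpow_natCast,
    ← ENNReal.rpow_mul, ← ENNReal.rpow_mul] at h2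
  norm_num at h2
  exact h2

/-- Young's inequality `ℓ¹ * ℓ² ⊆ ℓ²`. -/
theorem ennreal_tsum_conv_sq_le {G : Type*} [AddCommGroup G] (u v : G → ℝ≥0∞) :
    ∑' n, (∑' k, u k * v (n - k)) ^ 2 ≤ (∑' k, u k) ^ 2 * ∑' k, v k ^ 2 := by
  have hsq : ∀ x : ℝ≥0∞, x ^ (1 / 2 : ℝ) * x ^ (1 / 2 : ℝ) = x := fun x => by
    rw [← ENNReal.rpow_add_of_nonneg _ _ (by norm_num) (by norm_num)]
    norm_num
  have h1 : ∀ n, (∑' k, u k * v (n - k)) ^ 2 ≤ (∑' k, u k) * ∑' k, u k * v (n - k) ^ 2 := by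
    intro n
    have := ennreal_tsum_mul_sq_le (fun k => u k ^ (1 / 2 : ℝ))
      (fun k => u k ^ (1 / 2 : ℝ) * v (n - k))
    simpa only [← mul_assoc, hsq, mul_pow, sq (u _ ^ (1 / 2 : ℝ))] using this
  calc ∑' n, (∑' k, u k * v (n - k)) ^ 2
      ≤ ∑' n, (∑' k, u k) * ∑' k, u k * v (n - k) ^ 2 := ENNReal.tsum_le_tsum h1
    _ = (∑' k, u k) * ∑' k, u k * ∑' n, v (n - k) ^ 2 := by
        rw [ENNReal.tsum_mul_left, ENNReal.tsum_comm]
        simp_rw [ENNReal.tsum_mul_left]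
    _ = (∑' k, u k) * ∑' k, u k * ∑' n, v n ^ 2 := by
        congr 2 with k
        exact congrArg _ ((Equiv.subRight k).tsum_eq fun n => v n ^ 2)
    _ = _ := by rw [ENNReal.tsum_mul_right, sq, mul_assoc]

/-- A weighted form of the Cauchy–Schwarz inequality for convolutions. -/
theorem ennreal_tsum_kernel_conv_sq_le {G : Type*} [AddCommGroup G] (κ : G → G → ℝ≥0∞)
    (u v : G → ℝ≥0∞) {K : ℝ≥0∞} (hκ : ∀ n, ∑' k, κ n k ^ 2 ≤ K) :
    ∑' n, (∑' k, κ n k * (u k * v (n - k))) ^ 2 ≤ K * ((∑' k, u k ^ 2) * ∑' k, v k ^ 2) := by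
  calc ∑' n, (∑' k, κ n k * (u k * v (n - k))) ^ 2
      ≤ ∑' n, K * ∑' k, u k ^ 2 * v (n - k) ^ 2 := by
        refine ENNReal.tsum_le_tsum fun n => (ennreal_tsum_mul_sq_le _ _).trans ?_
        simp_rw [mul_pow]
        gcongr
        exact hκ n
    _ = K * ∑' k, u k ^ 2 * ∑' n, v (n - k) ^ 2 := by
        rw [ENNReal.tsum_mul_left, ENNReal.tsum_comm]
        simp_rw [ENNReal.tsum_mul_left]
    _ = K * ∑' k, u k ^ 2 * ∑' n, v n ^ 2 := by
        congr 2 with k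
        exact congrArg _ ((Equiv.subRight k).tsum_eq fun n => v n ^ 2)
    _ = _ := by rw [ENNReal.tsum_mul_right]

/-- `|ň_h|`, with values in `[0, ∞]`. -/
noncomputable def hNorm (a : Fin 3 → ℝ) (n : Fin 3 → ℤ) : ℝ≥0∞ :=
  ENNReal.ofReal √(freqHSq a n)

theorem hNorm_sq (a : Fin 3 → ℝ) (n : Fin 3 → ℤ) :
    hNorm a n ^ 2 = ENNReal.ofReal (freqHSq a n) := by
  rw [hNorm, ← ENNReal.ofReal_pow (Real.sqrt_nonneg _), Real.sq_sqrt (freqHSq_nonneg a n)]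

/-- A majorant for the `n`-th Fourier coefficient of `Ω v`, where `v` is the velocity and the
horizontal mean of `Ω`, on which `v · ∇_h` does not act, is left out; `X` stands for the moduli of
the Fourier coefficients of `Ω`. -/
noncomputable def convMajorant (a : Fin 3 → ℝ) (F : ℝ) (X : (Fin 3 → ℤ) → ℝ≥0∞)
    (n : Fin 3 → ℤ) : ℝ≥0∞ :=
  ∑' k, hNorm a k * ENNReal.ofReal (freqFSq a F k)⁻¹ *
    (X k * if freqHSq a (n - k) = 0 then 0 else X (n - k))

/-- The trilinear estimate: the product `Ω v` is bounded in a weighted `L²` by the weighted norm of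
`Ω` and by `‖∇_h Ω‖_{L²}`. When the weight falls on `Ω`, this is `‖v‖_{L^∞} ≲ ‖∇_h Ω‖_{L²}`; when
it falls on `v`, it is the product law `L^∞_v H^{1/2}_h × L²_v H^1_h → L²`. -/
theorem exists_convMajorant_bound {a : Fin 3 → ℝ} (ha : ∀ i, 0 < a i) {F : ℝ} (hF : 0 < F) :
    ∃ K : ℝ, 0 < K ∧ ∀ (lam : (Fin 3 → ℤ) → ℝ≥0∞) (Cs : ℝ≥0∞),
      (∀ n k, lam n ≤ Cs * (lam k + lam (n - k))) → ∀ X : (Fin 3 → ℤ) → ℝ≥0∞,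
      ∑' n, (lam n * convMajorant a F X n) ^ 2 ≤
        ENNReal.ofReal K * Cs ^ 2 * ((∑' n, (lam n * X n) ^ 2) * ∑' n, (hNorm a n * X n) ^ 2) := by
  obtain ⟨K₁, hK₁, hb₁⟩ := exists_inv_freqFSq_sq_le ha hF
  obtain ⟨K₂, hK₂, hb₂⟩ := exists_kernel_weight_le ha hF
  set W : ℝ≥0∞ := ∑' k, ENNReal.ofReal (latticeWeight k) with hW
  have hWtop : W ≠ ⊤ := summable_latticeWeight.tsum_ofReal_ne_top
  set A₁ : ℝ≥0∞ := ENNReal.ofReal K₁ * W with hA₁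
  set A₂ : ℝ≥0∞ := ENNReal.ofReal K₂ * (W + W) with hA₂
  have hA₁top : A₁ ≠ ⊤ := ENNReal.mul_ne_top ENNReal.ofReal_ne_top hWtop
  have hA₂top : A₂ ≠ ⊤ := ENNReal.mul_ne_top ENNReal.ofReal_ne_top (by simp [hWtop])
  have hsum₁ : ∑' k, ENNReal.ofReal (freqFSq a F k)⁻¹ ^ 2 ≤ A₁ := by
    rw [hA₁, hW, ← ENNReal.tsum_mul_left]
    refine ENNReal.tsum_le_tsum fun k => ?_
    rw [← ENNReal.ofReal_pow (inv_nonneg.mpr (freqFSq_nonneg a F k)),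
      ← ENNReal.ofReal_mul hK₁.le]
    exact ENNReal.ofReal_le_ofReal (hb₁ k)
  let κ : (Fin 3 → ℤ) → (Fin 3 → ℤ) → ℝ≥0∞ := fun n k =>
    hNorm a k * ENNReal.ofReal (freqFSq a F k)⁻¹ * ENNReal.ofReal (√(freqHSq a (n - k)))⁻¹
  have hsum₂ : ∀ n, ∑' k, κ n k ^ 2 ≤ A₂ := by
    intro n
    rw [hA₂, hW]
    nth_rewrite 2 [← tsum_latticeWeight_reflect n]
    rw [← ENNReal.tsum_add, ← ENNReal.tsum_mul_left]
    refine ENNReal.tsum_le_tsum fun k => ?_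
    have h1 := freqFSq_nonneg a F k
    have h2 := freqHSq_nonneg a k
    rw [mul_pow, mul_pow, hNorm_sq, ← ENNReal.ofReal_pow (by positivity),
      ← ENNReal.ofReal_pow (by positivity), ← ENNReal.ofReal_mul (by positivity),
      ← ENNReal.ofReal_mul (by positivity),
      ← ENNReal.ofReal_add (latticeWeight_nonneg _) (latticeWeight_nonneg _),
      ← ENNReal.ofReal_mul hK₂.le, inv_pow, inv_pow, Real.sq_sqrt (freqHSq_nonneg a (n - k)),
      ← inv_pow]
    exact ENNReal.ofReal_le_ofReal (hb₂ n k)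
  refine ⟨(2 * (A₁ + A₂)).toReal + 1, by positivity, fun lam Cs hlam X => ?_⟩
  set E : ℝ≥0∞ := ∑' n, (lam n * X n) ^ 2 with hE
  set D : ℝ≥0∞ := ∑' n, (hNorm a n * X n) ^ 2 with hD
  set P : (Fin 3 → ℤ) → ℝ≥0∞ := fun n => ∑' k, κ n k *
    ((lam k * X k) * (hNorm a (n - k) * X (n - k))) with hP
  set Q : (Fin 3 → ℤ) → ℝ≥0∞ := fun n => ∑' k, (ENNReal.ofReal (freqFSq a F k)⁻¹ *
    (hNorm a k * X k)) * (lam (n - k) * X (n - k)) with hQ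
  have hpt : ∀ n, lam n * convMajorant a F X n ≤ Cs * (P n + Q n) := by
    intro n
    rw [convMajorant, hP, hQ, ← ENNReal.tsum_add, ← ENNReal.tsum_mul_left, ← ENNReal.tsum_mul_left]
    refine ENNReal.tsum_le_tsum fun k => ?_
    have hX : (if freqHSq a (n - k) = 0 then 0 else X (n - k)) ≤
        ENNReal.ofReal (√(freqHSq a (n - k)))⁻¹ * (hNorm a (n - k) * X (n - k)) := by
      split_ifs with h
      · exact zero_le
      · have h2 : √(freqHSq a (n - k)) ≠ 0 :=
          (Real.sqrt_ne_zero (freqHSq_nonneg a (n - k))).mpr h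
        rw [hNorm, ← mul_assoc, ← ENNReal.ofReal_mul (by positivity), inv_mul_cancel₀ h2,
          ENNReal.ofReal_one, one_mul]
    have hX' : (if freqHSq a (n - k) = 0 then 0 else X (n - k)) ≤ X (n - k) := by
      split_ifs <;> simp
    calc lam n * (hNorm a k * ENNReal.ofReal (freqFSq a F k)⁻¹ *
          (X k * if freqHSq a (n - k) = 0 then 0 else X (n - k)))
        ≤ Cs * (lam k + lam (n - k)) * (hNorm a k * ENNReal.ofReal (freqFSq a F k)⁻¹ *
          (X k * if freqHSq a (n - k) = 0 then 0 else X (n - k))) := by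
          gcongr
          exact hlam n k
      _ = Cs * (hNorm a k * ENNReal.ofReal (freqFSq a F k)⁻¹ * ((lam k * X k) *
            if freqHSq a (n - k) = 0 then 0 else X (n - k)) +
          (ENNReal.ofReal (freqFSq a F k)⁻¹ * (hNorm a k * X k)) * (lam (n - k) *
            if freqHSq a (n - k) = 0 then 0 else X (n - k))) := by ring
      _ ≤ Cs * (hNorm a k * ENNReal.ofReal (freqFSq a F k)⁻¹ * ((lam k * X k) *
            (ENNReal.ofReal (√(freqHSq a (n - k)))⁻¹ * (hNorm a (n - k) * X (n - k)))) +
          (ENNReal.ofReal (freqFSq a F k)⁻¹ * (hNorm a k * X k)) * (lam (n - k) *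
            X (n - k))) := by gcongr
      _ = _ := by simp only [κ]; ring
  have hPsum : ∑' n, P n ^ 2 ≤ A₂ * (E * D) :=
    ennreal_tsum_kernel_conv_sq_le κ (fun k => lam k * X k) (fun k => hNorm a k * X k) hsum₂
  have hQsum : ∑' n, Q n ^ 2 ≤ A₁ * (E * D) := by
    refine (ennreal_tsum_conv_sq_le (fun k => ENNReal.ofReal (freqFSq a F k)⁻¹ *
      (hNorm a k * X k)) (fun k => lam k * X k)).trans ?_
    calc _ ≤ ((∑' k, ENNReal.ofReal (freqFSq a F k)⁻¹ ^ 2) * D) * E := by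
          gcongr
          exact ennreal_tsum_mul_sq_le _ _
      _ ≤ (A₁ * D) * E := by gcongr
      _ = _ := by ring
  have hadd : ∀ x y : ℝ≥0∞, (x + y) ^ 2 ≤ 2 * (x ^ 2 + y ^ 2) := by
    intro x y
    have := ENNReal.rpow_add_le_mul_rpow_add_rpow x y (p := 2) (by norm_num)
    norm_num at this
    exact this
  calc ∑' n, (lam n * convMajorant a F X n) ^ 2
      ≤ ∑' n, Cs ^ 2 * (2 * (P n ^ 2 + Q n ^ 2)) := by
        refine ENNReal.tsum_le_tsum fun n => (pow_le_pow_left' (hpt n) 2).trans ?_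
        rw [mul_pow]
        gcongr
        exact hadd _ _
    _ = Cs ^ 2 * (2 * ((∑' n, P n ^ 2) + ∑' n, Q n ^ 2)) := by
        rw [ENNReal.tsum_mul_left, ENNReal.tsum_mul_left, ENNReal.tsum_add]
    _ ≤ Cs ^ 2 * (2 * (A₂ * (E * D) + A₁ * (E * D))) := by gcongr
    _ = 2 * (A₁ + A₂) * Cs ^ 2 * (E * D) := by ring
    _ ≤ _ := by
        gcongr
        refine (ENNReal.ofReal_toReal ?_).symm.le.trans (ENNReal.ofReal_le_ofReal (by linarith))
        exact ENNReal.mul_ne_top (by simp) (by simp [hA₁top, hA₂top])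

/-! ### The nonlinearity in Fourier variables -/

/-- Young's inequality for products, in `[0, ∞]`. -/
theorem ennreal_two_mul_le {c : ℝ} (hc : 0 < c) (u v : ℝ≥0∞) :
    2 * (u * v) ≤ ENNReal.ofReal c * u ^ 2 + ENNReal.ofReal c⁻¹ * v ^ 2 := by
  by_cases hu : u = ⊤
  · subst hu
    rw [ENNReal.top_pow two_ne_zero, ENNReal.mul_top (a := ENNReal.ofReal c) (by simpa using hc),
      top_add]
    exact le_top
  by_cases hv : v = ⊤
  · subst hv
    rw [ENNReal.top_pow two_ne_zero, ENNReal.mul_top (a := ENNReal.ofReal c⁻¹) (by simpa using hc),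
      add_top]
    exact le_top
  rw [← ENNReal.ofReal_toReal hu, ← ENNReal.ofReal_toReal hv]
  set p := u.toReal
  set q := v.toReal
  have hp : 0 ≤ p := ENNReal.toReal_nonneg
  have hq : 0 ≤ q := ENNReal.toReal_nonneg
  rw [← ENNReal.ofReal_ofNat, ← ENNReal.ofReal_mul hp, ← ENNReal.ofReal_mul (by norm_num),
    ← ENNReal.ofReal_pow hp, ← ENNReal.ofReal_pow hq, ← ENNReal.ofReal_mul hc.le,
    ← ENNReal.ofReal_mul (by positivity), ← ENNReal.ofReal_add (by positivity) (by positivity)]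
  apply ENNReal.ofReal_le_ofReal
  have h : 0 ≤ c⁻¹ * (c * p - q) ^ 2 := by positivity
  have e : c⁻¹ * (c * p - q) ^ 2 = c * p ^ 2 + c⁻¹ * q ^ 2 - 2 * (p * q) := by
    field_simp; ring
  linarith

/-- The kernel `(ň_h^⊥ · ǩ_h) / |ǩ|_F²`, with `ň_h^⊥ = (ň₂, -ň₁)`, of the bilinear term
`v · ∇_h Ω` in Fourier variables; `k` is the frequency of the velocity. -/
noncomputable def kernel (a : Fin 3 → ℝ) (F : ℝ) (n k : Fin 3 → ℤ) : ℝ :=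
  (freq a n 1 * freq a k 0 - freq a n 0 * freq a k 1) * (freqFSq a F k)⁻¹

/-- The Fourier coefficients of `v · ∇_h Ω = div_h (Ω v)`, in terms of those of `Ω`. -/
noncomputable def nonlin (a : Fin 3 → ℝ) (F : ℝ) (x : (Fin 3 → ℤ) → ℂ) (n : Fin 3 → ℤ) : ℂ :=
  ∑' k, (kernel a F n k : ℂ) * (x k * x (n - k))

theorem abs_kernel_le (a : Fin 3 → ℝ) (F : ℝ) (n k : Fin 3 → ℤ) :
    |kernel a F n k| ≤ √(freqHSq a n) * (√(freqHSq a k) * (freqFSq a F k)⁻¹) := by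
  rw [kernel, abs_mul, abs_of_nonneg (inv_nonneg.mpr (freqFSq_nonneg a F k)), ← mul_assoc]
  gcongr
  · exact inv_nonneg.mpr (freqFSq_nonneg a F k)
  rw [← Real.sqrt_mul (freqHSq_nonneg a n)]
  apply Real.abs_le_sqrt
  simp only [freqHSq]
  nlinarith [sq_nonneg (freq a n 0 * freq a k 0 + freq a n 1 * freq a k 1)]

theorem freq_sub (a : Fin 3 → ℝ) (n k : Fin 3 → ℤ) (i : Fin 3) :
    freq a (n - k) i = freq a n i - freq a k i := by
  simp [freq, sub_div]

theorem freq_neg (a : Fin 3 → ℝ) (n : Fin 3 → ℤ) (i : Fin 3) : freq a (-n) i = -freq a n i := by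
  simp [freq, neg_div]

theorem freqHSq_neg (a : Fin 3 → ℝ) (n : Fin 3 → ℤ) : freqHSq a (-n) = freqHSq a n := by
  simp [freqHSq, freq_neg]

theorem freqFSq_neg (a : Fin 3 → ℝ) (F : ℝ) (n : Fin 3 → ℤ) :
    freqFSq a F (-n) = freqFSq a F n := by
  simp [freqFSq, freqHSq_neg, freq_neg]

/-- The velocity is orthogonal to its own frequency: the field is divergence free. -/
theorem kernel_sub (a : Fin 3 → ℝ) (F : ℝ) (n k : Fin 3 → ℤ) :
    kernel a F (n - k) k = kernel a F n k := by
  simp only [kernel, freq_sub]; ring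

theorem kernel_neg (a : Fin 3 → ℝ) (F : ℝ) (n k : Fin 3 → ℤ) :
    kernel a F n (-k) = -kernel a F n k := by
  simp only [kernel, freq_neg, freqFSq_neg]; ring

theorem kernel_eq_zero {a : Fin 3 → ℝ} (F : ℝ) {n k : Fin 3 → ℤ} (h : freqHSq a (n - k) = 0) :
    kernel a F n k = 0 := by
  have := abs_kernel_le a F (n - k) k
  rw [h, Real.sqrt_zero, zero_mul, kernel_sub] at this
  exact abs_nonpos_iff.mp this

theorem enorm_nonlin_term_le (a : Fin 3 → ℝ) (F : ℝ) (x : (Fin 3 → ℤ) → ℂ) (n k : Fin 3 → ℤ) :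
    ‖(kernel a F n k : ℂ) * (x k * x (n - k))‖ₑ ≤
      hNorm a n * (hNorm a k * ENNReal.ofReal (freqFSq a F k)⁻¹ *
        (‖x k‖ₑ * if freqHSq a (n - k) = 0 then 0 else ‖x (n - k)‖ₑ)) := by
  split_ifs with h
  · simp [kernel_eq_zero F h]
  · rw [enorm_mul, enorm_mul, ← mul_assoc (hNorm a n)]
    gcongr
    rw [hNorm, hNorm, ← ENNReal.ofReal_mul (Real.sqrt_nonneg _),
      ← ENNReal.ofReal_mul (Real.sqrt_nonneg _), ← ofReal_norm, Complex.norm_real]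
    exact ENNReal.ofReal_le_ofReal (abs_kernel_le a F n k)

theorem tsum_enorm_nonlin_term_le (a : Fin 3 → ℝ) (F : ℝ) (x : (Fin 3 → ℤ) → ℂ)
    (n : Fin 3 → ℤ) :
    ∑' k, ‖(kernel a F n k : ℂ) * (x k * x (n - k))‖ₑ ≤
      hNorm a n * convMajorant a F (fun k => ‖x k‖ₑ) n := by
  rw [convMajorant, ← ENNReal.tsum_mul_left]
  exact ENNReal.tsum_le_tsum fun k => enorm_nonlin_term_le a F x n k

theorem enorm_nonlin_le (a : Fin 3 → ℝ) (F : ℝ) (x : (Fin 3 → ℤ) → ℂ) (n : Fin 3 → ℤ) :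
    ‖nonlin a F x n‖ₑ ≤ hNorm a n * convMajorant a F (fun k => ‖x k‖ₑ) n :=
  enorm_tsum_le_tsum_enorm.trans (tsum_enorm_nonlin_term_le a F x n)

/-- The trilinear form `(v · ∇_h Ω | Ω)`, with weights and with absolute values everywhere. -/
noncomputable def trilinear (a : Fin 3 → ℝ) (F : ℝ) (lam X : (Fin 3 → ℤ) → ℝ≥0∞) : ℝ≥0∞ :=
  ∑' n, lam n ^ 2 * (X n * (hNorm a n * convMajorant a F X n))

theorem exists_trilinear_bound {a : Fin 3 → ℝ} (ha : ∀ i, 0 < a i) {F : ℝ} (hF : 0 < F) :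
    ∃ K : ℝ, 0 < K ∧ ∀ (lam : (Fin 3 → ℤ) → ℝ≥0∞) (Cs : ℝ≥0∞),
      (∀ n k, lam n ≤ Cs * (lam k + lam (n - k))) → ∀ (X : (Fin 3 → ℤ) → ℝ≥0∞) (c : ℝ), 0 < c →
      2 * trilinear a F lam X ≤
        ENNReal.ofReal c * ∑' n, (lam n * (hNorm a n * X n)) ^ 2 +
        ENNReal.ofReal c⁻¹ * (ENNReal.ofReal K * Cs ^ 2 *
          ((∑' n, (lam n * X n) ^ 2) * ∑' n, (hNorm a n * X n) ^ 2)) := by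
  obtain ⟨K, hK, hb⟩ := exists_convMajorant_bound ha hF
  refine ⟨K, hK, fun lam Cs hlam X c hc => ?_⟩
  refine le_trans ?_ (add_le_add_right (mul_le_mul_right (hb lam Cs hlam X) _) _)
  rw [trilinear, ← ENNReal.tsum_mul_left, ← ENNReal.tsum_mul_left, ← ENNReal.tsum_mul_left,
    ← ENNReal.tsum_add]
  refine ENNReal.tsum_le_tsum fun n => ?_
  refine le_trans (le_of_eq ?_) (ennreal_two_mul_le hc _ _)
  ring

/-- The cancellation `(v · ∇_h Ω | Ω)_{L²} = 0`, from the skew-symmetry of the kernel under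
`(n, k) ↦ (n - k, -k)`. -/
theorem hasSum_nonlin_eq_zero {a : Fin 3 → ℝ} {F : ℝ} {x : (Fin 3 → ℤ) → ℂ}
    (hx : ∀ n, x (-n) = starRingEnd ℂ (x n)) (hfin : trilinear a F 1 (fun n => ‖x n‖ₑ) ≠ ⊤) :
    HasSum (fun n => (starRingEnd ℂ (x n) * nonlin a F x n).re) 0 := by
  let T : (Fin 3 → ℤ) × (Fin 3 → ℤ) → ℂ := fun p =>
    starRingEnd ℂ (x p.1) * ((kernel a F p.1 p.2 : ℂ) * (x p.2 * x (p.1 - p.2)))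
  have hT : Summable T := by
    apply Summable.of_enorm
    refine ne_top_of_le_ne_top hfin ?_
    rw [ENNReal.tsum_prod (f := fun n k => ‖T (n, k)‖ₑ), trilinear]
    refine ENNReal.tsum_le_tsum fun n => ?_
    simp only [T, enorm_mul (starRingEnd ℂ (x n)), ENNReal.tsum_mul_left, Pi.one_apply, one_pow,
      one_mul]
    refine mul_le_mul' ?_ (tsum_enorm_nonlin_term_le a F x n)
    rw [← ofReal_norm, ← ofReal_norm, RCLike.norm_conj]
  let e : (Fin 3 → ℤ) × (Fin 3 → ℤ) ≃ (Fin 3 → ℤ) × (Fin 3 → ℤ) :=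
    { toFun := fun p => (p.1 - p.2, -p.2)
      invFun := fun p => (p.1 - p.2, -p.2)
      left_inv := fun p => by simp
      right_inv := fun p => by simp }
  have hskew : ∀ p, T (e p) = -starRingEnd ℂ (T p) := by
    rintro ⟨n, k⟩
    simp only [T, e, Equiv.coe_fn_mk, kernel_neg, kernel_sub, hx, sub_neg_eq_add, sub_add_cancel,
      map_mul, Complex.conj_conj, Complex.conj_ofReal, Complex.ofReal_neg]
    ring
  have hre : (∑' p, T p).re = 0 := by
    have h1 : ∑' p, T p = -starRingEnd ℂ (∑' p, T p) := by
      conv_lhs => rw [← e.tsum_eq T]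
      simp_rw [hskew]
      rw [tsum_neg, Complex.conj_tsum]
    have h2 := congrArg Complex.re h1
    simp only [Complex.neg_re, Complex.conj_re] at h2
    linarith
  have h3 : HasSum (fun n => starRingEnd ℂ (x n) * nonlin a F x n) (∑' p, T p) := by
    refine (hT.hasSum.prod_fiberwise fun n => (hT.prod_factor n).hasSum).congr_fun fun n => ?_
    simp only [T, nonlin, tsum_mul_left]
  have h4 := Complex.hasSum_re h3
  rwa [hre] at h4

theorem measurable_nonlin {α : Type*} [MeasurableSpace α] {a : Fin 3 → ℝ} {F : ℝ}
    {x : α → (Fin 3 → ℤ) → ℂ} (hx : ∀ n, Measurable fun t => x t n) (n : Fin 3 → ℤ) :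
    Measurable fun t => nonlin a F (x t) n :=
  Measurable.tsum fun k => ((hx k).mul (hx (n - k))).const_mul _

theorem measurable_convMajorant {α : Type*} [MeasurableSpace α] {a : Fin 3 → ℝ} {F : ℝ}
    {X : α → (Fin 3 → ℤ) → ℝ≥0∞} (hX : ∀ n, Measurable fun t => X t n) (n : Fin 3 → ℤ) :
    Measurable fun t => convMajorant a F (X t) n := by
  refine Measurable.tsum fun k => ((hX k).mul ?_).const_mul _
  split_ifs
  · exact measurable_const
  · exact hX (n - k)

/-- The nonlinear term is integrable in time for bounded families with `∇_h Ω ∈ L²L²`. -/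
theorem integrable_nonlin {α : Type*} [MeasurableSpace α] {μ : Measure α} [IsFiniteMeasure μ]
    {a : Fin 3 → ℝ} (ha : ∀ i, 0 < a i) {F : ℝ} (hF : 0 < F) {x : α → (Fin 3 → ℤ) → ℂ}
    (hx : ∀ n, Measurable fun t => x t n) {M : ℝ≥0∞} (hM : M ≠ ⊤)
    (hb : ∀ᵐ t ∂μ, ∑' n, ‖x t n‖ₑ ^ 2 ≤ M)
    (hg : ∫⁻ t, ∑' n, (hNorm a n * ‖x t n‖ₑ) ^ 2 ∂μ ≠ ⊤) (n : Fin 3 → ℤ) :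
    Integrable (fun t => nonlin a F (x t) n) μ := by
  obtain ⟨K, hK, hconv⟩ := exists_convMajorant_bound ha hF
  refine ⟨(measurable_nonlin hx n).aestronglyMeasurable, ?_⟩
  have h1 : ∀ᵐ t ∂μ, ‖nonlin a F (x t) n‖ₑ ≤
      hNorm a n * (1 + ENNReal.ofReal K * (M * ∑' n, (hNorm a n * ‖x t n‖ₑ) ^ 2)) := by
    filter_upwards [hb] with t ht
    refine (enorm_nonlin_le a F (x t) n).trans ?_
    gcongr
    have h2 := hconv 1 1 (fun n k => by simp) (fun n => ‖x t n‖ₑ)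
    simp only [Pi.one_apply, one_mul, one_pow, mul_one] at h2
    set q := convMajorant a F (fun k => ‖x t k‖ₑ) n
    have h3 : q ^ 2 ≤ ENNReal.ofReal K * (M * ∑' n, (hNorm a n * ‖x t n‖ₑ) ^ 2) := by
      refine (ENNReal.le_tsum (f := fun n => convMajorant a F (fun k => ‖x t k‖ₑ) n ^ 2) n).trans
        (h2.trans ?_)
      gcongr
    refine le_trans ?_ (add_le_add_right h3 1)
    rcases le_total q 1 with h | h
    · exact h.trans le_self_add
    · exact (le_self_pow h two_ne_zero).trans le_add_self
  refine (lintegral_mono_ae h1).trans_lt ?_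
  have hD : Measurable fun t => ∑' n, (hNorm a n * ‖x t n‖ₑ) ^ 2 :=
    Measurable.tsum fun n => (((hx n).enorm).const_mul _).pow_const 2
  rw [lintegral_const_mul _ (((hD.const_mul _).const_mul _).const_add _),
    lintegral_add_left measurable_const, lintegral_const_mul _ (hD.const_mul _),
    lintegral_const_mul _ hD]
  refine ENNReal.mul_lt_top ENNReal.ofReal_lt_top (ENNReal.add_lt_top.mpr ⟨by simp, ?_⟩)
  exact ENNReal.mul_lt_top ENNReal.ofReal_lt_top (ENNReal.mul_lt_top hM.lt_top hg.lt_top)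

/-! ### Integral equations in time -/

theorem sq_eq_of_eq_integral {f g : ℝ → ℝ} {t : ℝ} (ht : 0 ≤ t)
    (hg : IntervalIntegrable g volume 0 t)
    (hf : ∀ s ∈ Set.Icc 0 t, f s = f 0 + ∫ τ in 0..s, g τ) :
    f t ^ 2 = f 0 ^ 2 + 2 * ∫ τ in 0..t, f τ * g τ := by
  have hac := hg.absolutelyContinuousOnInterval_intervalIntegral (c := 0) (by simp)
  have hac' : AbsolutelyContinuousOnInterval (fun s => f 0 + ∫ τ in 0..s, g τ) 0 t :=
    (contDiff_const (c := f 0) (n := 1)).contDiffOn.absolutelyContinuousOnInterval.fun_add hac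
  have h := hac'.integral_deriv_mul_eq_sub hac'
  have h2 : ∫ τ in 0..t, f τ * g τ = ∫ x in 0..t,
      deriv (fun s => f 0 + ∫ τ in 0..s, g τ) x * (f 0 + ∫ τ in 0..x, g τ) := by
    apply intervalIntegral.integral_congr_ae
    filter_upwards [hg.ae_hasDerivAt_integral] with x hx hxt
    have hx' := Set.uIoc_subset_uIcc hxt
    have h3 := (hx hx' 0 (by simp)).const_add (f 0)
    rw [h3.deriv, ← hf x (by rwa [Set.uIcc_of_le ht] at hx'), mul_comm]
  have h4 : ∀ x, deriv (fun s => f 0 + ∫ τ in 0..s, g τ) x * (f 0 + ∫ τ in 0..x, g τ) +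
      (f 0 + ∫ τ in 0..x, g τ) * deriv (fun s => f 0 + ∫ τ in 0..s, g τ) x =
      2 * (deriv (fun s => f 0 + ∫ τ in 0..s, g τ) x * (f 0 + ∫ τ in 0..x, g τ)) :=
    fun x => by ring
  simp_rw [h4] at h
  rw [intervalIntegral.integral_const_mul, ← h2, ← hf t ⟨ht, le_rfl⟩,
    ← hf 0 ⟨le_rfl, ht⟩] at h
  rw [h]; ring

/-- The evolution of `|f|²` when `f' = g` in the integrated sense. -/
theorem norm_sq_eq_of_eq_integral {f g : ℝ → ℂ} {t : ℝ} (ht : 0 ≤ t)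
    (hg : IntervalIntegrable g volume 0 t) (hfc : Continuous f)
    (hf : ∀ s ∈ Set.Icc 0 t, f s = f 0 + ∫ τ in 0..s, g τ) :
    ‖f t‖ ^ 2 = ‖f 0‖ ^ 2 + 2 * ∫ τ in 0..t, (starRingEnd ℂ (f τ) * g τ).re := by
  have hint : ∀ s ∈ Set.Icc 0 t, IntervalIntegrable g volume 0 s := fun s hs =>
    hg.mono_set (by
      rw [Set.uIcc_of_le hs.1, Set.uIcc_of_le ht]
      exact Set.Icc_subset_Icc le_rfl hs.2)
  have hgre : IntervalIntegrable (fun τ => (g τ).re) volume 0 t := ⟨hg.1.re, hg.2.re⟩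
  have hgim : IntervalIntegrable (fun τ => (g τ).im) volume 0 t := ⟨hg.1.im, hg.2.im⟩
  have h1 := sq_eq_of_eq_integral (f := fun s => (f s).re) ht hgre (fun s hs => by
    have h := congrArg Complex.re (hf s hs)
    rw [Complex.add_re] at h
    rw [h, ← Complex.reCLM_apply (∫ τ in 0..s, g τ),
      ← Complex.reCLM.intervalIntegral_comp_comm (hint s hs)]
    rfl)
  have h2 := sq_eq_of_eq_integral (f := fun s => (f s).im) ht hgim (fun s hs => by
    have h := congrArg Complex.im (hf s hs)
    rw [Complex.add_im] at h
    rw [h, ← Complex.imCLM_apply (∫ τ in 0..s, g τ),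
      ← Complex.imCLM.intervalIntegral_comp_comm (hint s hs)]
    rfl)
  have h3 : ∫ τ in 0..t, (starRingEnd ℂ (f τ) * g τ).re =
      (∫ τ in 0..t, (f τ).re * (g τ).re) + ∫ τ in 0..t, (f τ).im * (g τ).im := by
    rw [← intervalIntegral.integral_add]
    · congr 1
      funext τ
      simp [Complex.mul_re]
    · exact hgre.continuousOn_mul (Complex.continuous_re.comp hfc).continuousOn
    · exact hgim.continuousOn_mul (Complex.continuous_im.comp hfc).continuousOn
  rw [h3, Complex.sq_norm, Complex.sq_norm, Complex.normSq_apply, Complex.normSq_apply]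
  linear_combination h1 + h2

/-- Grönwall's inequality with an integrable coefficient. The factor `2` in the exponent allows a
proof by continuous induction: over a short time, `1 / (1 - δ) ≤ exp (2 δ)`. -/
theorem gronwall_integral {g y : ℝ → ℝ} {A T : ℝ} (hA : 0 ≤ A) (hT : 0 ≤ T)
    (hg : IntegrableOn g (Set.Icc 0 T)) (hg0 : ∀ t, 0 ≤ g t)
    (hgy : IntegrableOn (fun t => g t * y t) (Set.Icc 0 T)) (hy0 : ∀ t, 0 ≤ y t)
    (h : ∀ t ∈ Set.Icc 0 T, y t ≤ A + ∫ τ in 0..t, g τ * y τ) :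
    A + ∫ τ in 0..T, g τ * y τ ≤ A * Real.exp (2 * ∫ τ in 0..T, g τ) := by
  set Z : ℝ → ℝ := fun t => A + ∫ τ in 0..t, g τ * y τ with hZ
  set G : ℝ → ℝ := fun t => ∫ τ in 0..t, g τ with hG
  have hZc : ContinuousOn Z (Set.Icc 0 T) := by
    have := intervalIntegral.continuousOn_primitive_interval (a := 0) (b := T)
      (by rwa [Set.uIcc_of_le hT])
    rw [Set.uIcc_of_le hT] at this
    exact continuousOn_const.add this
  have hGc : ContinuousOn G (Set.Icc 0 T) := by
    have := intervalIntegral.continuousOn_primitive_interval (a := 0) (b := T) (f := g)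
      (μ := volume)
      (by rwa [Set.uIcc_of_le hT])
    rwa [Set.uIcc_of_le hT] at this
  have hii : ∀ {f : ℝ → ℝ}, IntegrableOn f (Set.Icc 0 T) → ∀ s t, 0 ≤ s → s ≤ t → t ≤ T →
      IntervalIntegrable f volume s t := by
    intro f hf s t hs hst htT
    rw [intervalIntegrable_iff_integrableOn_Icc_of_le hst]
    exact hf.mono_set (Set.Icc_subset_Icc hs htT)
  have hZsub : ∀ s t, 0 ≤ s → s ≤ t → t ≤ T → Z t = Z s + ∫ τ in s..t, g τ * y τ := by
    intro s t hs hst htT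
    simp only [hZ]
    rw [← intervalIntegral.integral_add_adjacent_intervals (hii hgy 0 s le_rfl hs (hst.trans htT))
      (hii hgy s t hs hst htT)]
    ring
  have hGsub : ∀ s t, 0 ≤ s → s ≤ t → t ≤ T → G t = G s + ∫ τ in s..t, g τ := by
    intro s t hs hst htT
    simp only [hG]
    rw [← intervalIntegral.integral_add_adjacent_intervals (hii hg 0 s le_rfl hs (hst.trans htT))
      (hii hg s t hs hst htT)]
  have hZmono : ∀ s t, 0 ≤ s → s ≤ t → t ≤ T → Z s ≤ Z t := by
    intro s t hs hst htT
    rw [hZsub s t hs hst htT]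
    have := intervalIntegral.integral_nonneg (μ := volume) hst
      (fun τ _ => mul_nonneg (hg0 τ) (hy0 τ))
    linarith
  have hstep : ∀ s t, 0 ≤ s → s ≤ t → t ≤ T → G t - G s ≤ 1 / 2 →
      Z t ≤ Z s * Real.exp (2 * (G t - G s)) := by
    intro s t hs hst htT hδ
    set δ := G t - G s with hδdef
    have hδe : δ = ∫ τ in s..t, g τ := by rw [hδdef, hGsub s t hs hst htT]; ring
    have hδ0 : 0 ≤ δ := by
      rw [hδe]; exact intervalIntegral.integral_nonneg hst (fun τ _ => hg0 τ)
    have h1 : Z t ≤ Z s + Z t * δ := by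
      conv_lhs => rw [hZsub s t hs hst htT]
      rw [hδe, ← intervalIntegral.integral_const_mul]
      gcongr
      apply intervalIntegral.integral_mono_on hst (hii hgy s t hs hst htT)
        ((hii hg s t hs hst htT).const_mul _)
      intro τ hτ
      rw [mul_comm]
      gcongr
      · exact hg0 τ
      · exact (h τ ⟨hs.trans hτ.1, hτ.2.trans htT⟩).trans
          (hZmono τ t (hs.trans hτ.1) hτ.2 htT)
    have hZ0 : 0 ≤ Z t := by
      have := hZmono 0 t le_rfl (hs.trans hst) htT
      simp only [hZ, intervalIntegral.integral_same, add_zero] at this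
      exact hA.trans this
    have hexp : 1 + 2 * δ ≤ Real.exp (2 * δ) := by linarith [Real.add_one_le_exp (2 * δ)]
    calc Z t ≤ Z t * ((1 - δ) * (1 + 2 * δ)) := by nlinarith [mul_nonneg hZ0 hδ0]
      _ = (Z t - Z t * δ) * (1 + 2 * δ) := by ring
      _ ≤ Z s * (1 + 2 * δ) := by gcongr; linarith
      _ ≤ Z s * Real.exp (2 * δ) := by
          gcongr
          nlinarith
  have hall : Set.Icc 0 T ⊆ {t | Z t ≤ A * Real.exp (2 * G t)} := by
    apply IsClosed.Icc_subset_of_forall_exists_gt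
    · have hc : ContinuousOn (fun t => A * Real.exp (2 * G t)) (Set.Icc 0 T) :=
        continuousOn_const.mul (Real.continuous_exp.comp_continuousOn
          (continuousOn_const.mul hGc))
      rw [Set.inter_comm]
      exact isClosed_Icc.isClosed_le hZc hc
    · simp [hZ, hG]
    · rintro t ⟨htS, ht⟩ b hb
      have hGt : Tendsto G (𝓝[>] t) (𝓝 (G t)) := by
        have h1 := (hGc t ⟨ht.1, ht.2.le⟩).mono
          (Set.Ioc_subset_Icc_self.trans (Set.Icc_subset_Icc ht.1 le_rfl) :
            Set.Ioc t T ⊆ Set.Icc 0 T)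
        rwa [ContinuousWithinAt, nhdsWithin_Ioc_eq_nhdsGT ht.2] at h1
      have h1 : ∀ᶠ s in 𝓝[>] t, G s < G t + 1 / 2 :=
        hGt.eventually (gt_mem_nhds (by linarith))
      have h2 : ∀ᶠ s in 𝓝[>] t, s ∈ Set.Ioc t (min b T) :=
        Ioc_mem_nhdsGT (lt_min hb ht.2)
      obtain ⟨s, hs1, hs2⟩ := (h1.and h2).exists
      refine ⟨s, ?_, hs2.1, hs2.2.trans (min_le_left _ _)⟩
      have hsT := hs2.2.trans (min_le_right _ _)
      have := hstep t s ht.1 hs2.1.le hsT (by linarith)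
      refine this.trans ?_
      have hE : Real.exp (2 * G s) = Real.exp (2 * G t) * Real.exp (2 * (G s - G t)) := by
        rw [← Real.exp_add]; ring_nf
      rw [hE, ← mul_assoc]
      have htS' : Z t ≤ A * Real.exp (2 * G t) := htS
      gcongr
  exact hall ⟨hT, le_rfl⟩

/-- A weak solution on `[0, ∞)` of `f' = g`, `f(0) = f₀`, satisfies the integrated equation. -/
theorem ae_eq_add_integral_of_weak {f g : ℝ → ℝ} {f₀ : ℝ}
    (hf : ∀ T, IntegrableOn f (Set.Icc 0 T)) (hg : ∀ T, IntegrableOn g (Set.Icc 0 T))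
    (h : ∀ χ : ℝ → ℝ, ContDiff ℝ ((⊤ : ℕ∞) : WithTop ℕ∞) χ → (∃ T, ∀ t, T ≤ t → χ t = 0) →
      (∫ t in Set.Ici (0 : ℝ), (f t * deriv χ t + g t * χ t)) + f₀ * χ 0 = 0) :
    ∀ᵐ t ∂volume.restrict (Set.Ici (0 : ℝ)), f t = f₀ + ∫ τ in 0..t, g τ := by
  set P : ℝ → ℝ := fun t => f₀ + ∫ τ in 0..t, g τ with hP
  have hgi : ∀ T, 0 ≤ T → IntervalIntegrable g volume 0 T := fun T hT => by
    rw [intervalIntegrable_iff_integrableOn_Icc_of_le hT]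
    exact hg T
  have hPc : ∀ T, 0 ≤ T → ContinuousOn P (Set.Icc 0 T) := fun T hT => by
    have := intervalIntegral.continuousOn_primitive_interval (a := 0) (b := T) (f := g)
      (μ := volume) (by rw [Set.uIcc_of_le hT]; exact hg T)
    rw [Set.uIcc_of_le hT] at this
    exact continuousOn_const.add this
  have hPi : ∀ T, IntegrableOn P (Set.Icc 0 T) := fun T => by
    rcases le_or_gt 0 T with hT | hT
    · exact (hPc T hT).integrableOn_Icc
    · rw [Set.Icc_eq_empty (by linarith)]; exact integrableOn_empty
  have hloc : LocallyIntegrable ((Set.Ici (0 : ℝ)).indicator fun t => f t - P t) := by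
    rw [locallyIntegrable_iff]
    intro k hk
    obtain ⟨R, hR⟩ := hk.bddAbove
    rw [integrableOn_indicator_iff measurableSet_Ici]
    refine ((hf R).sub (hPi R)).mono_set ?_
    exact fun t ht => ⟨ht.1, hR ht.2⟩
  have hzero := ae_eq_zero_of_integral_contDiff_smul_eq_zero hloc (fun η hη hηs => ?_)
  · rw [ae_restrict_iff' measurableSet_Ici]
    filter_upwards [hzero] with t ht ht0
    rw [Set.indicator_of_mem ht0] at ht
    linarith
  · obtain ⟨R₀, hR₀⟩ := hηs.isCompact.bddAbove
    set R := max R₀ 0 + 1 with hRdef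
    have hR0 : 0 ≤ R := by positivity
    have hηR : ∀ t, R ≤ t → η t = 0 := by
      intro t ht
      apply image_eq_zero_of_notMem_tsupport
      intro hmem
      have := hR₀ hmem
      linarith [le_max_left R₀ 0]
    -- the primitive of `η` that vanishes for large times is a test function
    set χ : ℝ → ℝ := fun t => (∫ τ in 0..t, η τ) - ∫ τ in 0..R, η τ with hχ
    have hχd : ∀ t, HasDerivAt χ (η t) t := fun t =>
      (intervalIntegral.integral_hasDerivAt_right (hη.continuous.intervalIntegrable _ _)
        hη.continuous.stronglyMeasurable.stronglyMeasurableAtFilter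
        hη.continuous.continuousAt).sub_const _
    have hχderiv : deriv χ = η := funext fun t => (hχd t).deriv
    have hχs : ContDiff ℝ ((⊤ : ℕ∞) : WithTop ℕ∞) χ := by
      rw [contDiff_infty_iff_deriv, hχderiv]
      exact ⟨fun t => (hχd t).differentiableAt, hη⟩
    have hχR : ∀ t, R ≤ t → χ t = 0 := by
      intro t ht
      simp only [hχ]
      rw [← intervalIntegral.integral_add_adjacent_intervals
        (hη.continuous.intervalIntegrable 0 R) (hη.continuous.intervalIntegrable R t)]
      have : ∫ τ in R..t, η τ = 0 := by
        rw [← intervalIntegral.integral_zero (μ := volume) (a := R) (b := t)]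
        apply intervalIntegral.integral_congr
        intro τ hτ
        rw [Set.uIcc_of_le ht] at hτ
        exact hηR τ hτ.1
      rw [this]; ring
    have key := h χ hχs ⟨R, hχR⟩
    rw [hχderiv] at key
    have hcut : ∀ q : ℝ → ℝ, (∀ t, R ≤ t → q t = 0) →
        ∫ t in Set.Ici (0 : ℝ), q t = ∫ t in Set.Icc 0 R, q t := by
      intro q hq
      apply setIntegral_eq_of_subset_of_forall_sdiff_eq_zero measurableSet_Ici
        Set.Icc_subset_Ici_self
      rintro t ⟨ht0, htR⟩
      apply hq
      by_contra hlt
      exact htR ⟨ht0, by linarith⟩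
    rw [hcut _ (fun t ht => by rw [hηR t ht, hχR t ht]; ring)] at key
    have hfη : IntegrableOn (fun t => f t * η t) (Set.Icc 0 R) :=
      (hf R).mul_continuousOn hη.continuous.continuousOn isCompact_Icc
    have hPη : IntegrableOn (fun t => P t * η t) (Set.Icc 0 R) :=
      (hPi R).mul_continuousOn hη.continuous.continuousOn isCompact_Icc
    have hgχ : IntegrableOn (fun t => g t * χ t) (Set.Icc 0 R) :=
      (hg R).mul_continuousOn hχs.continuous.continuousOn isCompact_Icc
    have hparts : (∫ t in Set.Icc 0 R, (P t * η t + g t * χ t)) + f₀ * χ 0 = 0 := by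
      have hacP : AbsolutelyContinuousOnInterval P 0 R :=
        (contDiff_const (c := f₀) (n := 1)).contDiffOn.absolutelyContinuousOnInterval.fun_add
          ((hgi R hR0).absolutelyContinuousOnInterval_intervalIntegral (c := 0) (by simp))
      have hacχ : AbsolutelyContinuousOnInterval χ 0 R :=
        (hχs.of_le (by norm_cast) : ContDiff ℝ 1 χ).contDiffOn
          |>.absolutelyContinuousOnInterval
      have hbp := hacP.integral_deriv_mul_eq_sub hacχ
      rw [hχR R le_rfl, hχderiv] at hbp
      have hP0 : P 0 = f₀ := by simp [hP]
      rw [hP0] at hbp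
      have heq : ∫ t in Set.Icc 0 R, (P t * η t + g t * χ t) =
          ∫ t in 0..R, (deriv P t * χ t + P t * η t) := by
        rw [integral_Icc_eq_integral_Ioc, ← intervalIntegral.integral_of_le hR0]
        apply intervalIntegral.integral_congr_ae
        filter_upwards [(hgi R hR0).ae_hasDerivAt_integral] with t ht htR
        have h3 := (ht (Set.uIoc_subset_uIcc htR) 0 (by simp)).const_add f₀
        rw [show deriv P t = g t from h3.deriv]
        ring
      rw [heq, hbp]; ring
    have hind : ∀ t, η t • (Set.Ici (0 : ℝ)).indicator (fun t => f t - P t) t =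
        (Set.Ici (0 : ℝ)).indicator (fun t => η t * (f t - P t)) t := by
      intro t
      by_cases ht : t ∈ Set.Ici (0 : ℝ) <;> simp [ht]
    simp_rw [hind]
    rw [integral_indicator measurableSet_Ici, hcut _ (fun t ht => by rw [hηR t ht, zero_mul])]
    rw [integral_add hfη hgχ] at key
    rw [integral_add hPη hgχ] at hparts
    have : ∫ t in Set.Icc 0 R, η t * (f t - P t) =
        (∫ t in Set.Icc 0 R, f t * η t) - ∫ t in Set.Icc 0 R, P t * η t := by
      rw [← integral_sub hfη hPη]
      congr 1
      funext t
      ring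
    rw [this]
    linarith

/-! ### The evolution of the Fourier coefficients -/

theorem symbolQG_lower_bound {a : Fin 3 → ℝ} (ha : ∀ i, 0 < a i) {F ν ν' : ℝ} (hF : 0 < F)
    (n : Fin 3 → ℤ) : min ν ν' * freqHSq a n ≤ symbolQG a F ν ν' n := by
  by_cases hn : n = 0
  · subst hn
    simp [symbolQG, freqHSq, freq]
  · have h := freqFSq_pos ha hF hn
    have h2 := freqHSq_nonneg a n
    rw [symbolQG]
    gcongr
    rw [le_div_iff₀ h, freqFSq, mul_add]
    have h3 : 0 ≤ F ^ 2 * freq a n 2 ^ 2 := by positivity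
    rw [mul_assoc ν']
    gcongr
    · exact min_le_left _ _
    · exact min_le_right _ _

/-- A family `x` of Fourier coefficients, of a real function in the energy space, that satisfies
the potential vorticity equation mode by mode, in integrated form. -/
structure IsModeSolution (a : Fin 3 → ℝ) (F ν ν' : ℝ) (x : ℝ → (Fin 3 → ℤ) → ℂ) : Prop where
  continuous : ∀ n, Continuous fun t => x t n
  hermitian : ∀ t, 0 ≤ t → ∀ n, x t (-n) = starRingEnd ℂ (x t n)
  bounded : ∀ T, ∃ M : ℝ≥0∞, M ≠ ⊤ ∧ ∀ t ∈ Set.Icc 0 T, ∑' n, ‖x t n‖ₑ ^ 2 ≤ M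
  gradient : ∀ T, ∫⁻ t in Set.Icc 0 T, ∑' n, (hNorm a n * ‖x t n‖ₑ) ^ 2 ≠ ⊤
  equation : ∀ n t, 0 ≤ t →
    x t n = x 0 n - ∫ τ in 0..t, ((symbolQG a F ν ν' n : ℂ) * x τ n + nonlin a F (x τ) n)

namespace IsModeSolution

variable {a : Fin 3 → ℝ} {F ν ν' : ℝ} {x : ℝ → (Fin 3 → ℤ) → ℂ}

theorem measurable_enorm (hx : IsModeSolution a F ν ν' x) (n : Fin 3 → ℤ) :
    Measurable fun t => ‖x t n‖ₑ :=
  (hx.continuous n).measurable.enorm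

theorem measurable_wsum (hx : IsModeSolution a F ν ν' x) (w : (Fin 3 → ℤ) → ℝ≥0∞) :
    Measurable fun t => ∑' n, (w n * ‖x t n‖ₑ) ^ 2 :=
  Measurable.tsum fun n => ((hx.measurable_enorm n).const_mul _).pow_const 2

theorem measurable_wgrad (hx : IsModeSolution a F ν ν' x) (w : (Fin 3 → ℤ) → ℝ≥0∞) :
    Measurable fun t => ∑' n, (w n * (hNorm a n * ‖x t n‖ₑ)) ^ 2 :=
  Measurable.tsum fun n => (((hx.measurable_enorm n).const_mul _).const_mul _).pow_const 2

theorem measurable_trilinear_term (hx : IsModeSolution a F ν ν' x) (n : Fin 3 → ℤ) :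
    Measurable fun t => ‖x t n‖ₑ * (hNorm a n * convMajorant a F (fun k => ‖x t k‖ₑ) n) :=
  (hx.measurable_enorm n).mul ((measurable_convMajorant hx.measurable_enorm n).const_mul _)

theorem integrable_nonlin (hx : IsModeSolution a F ν ν' x) (ha : ∀ i, 0 < a i) (hF : 0 < F)
    (n : Fin 3 → ℤ) (T : ℝ) : IntegrableOn (fun t => nonlin a F (x t) n) (Set.Icc 0 T) := by
  obtain ⟨M, hM, hb⟩ := hx.bounded T
  exact QG.integrable_nonlin ha hF (fun n => (hx.continuous n).measurable) hM
    ((ae_restrict_iff' measurableSet_Icc).mpr (Eventually.of_forall hb)) (hx.gradient T) n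

theorem integrable_transfer (hx : IsModeSolution a F ν ν' x) (ha : ∀ i, 0 < a i) (hF : 0 < F)
    (n : Fin 3 → ℤ) (T : ℝ) :
    IntegrableOn (fun t => (starRingEnd ℂ (x t n) * nonlin a F (x t) n).re) (Set.Icc 0 T) :=
  ((hx.integrable_nonlin ha hF n T).continuousOn_mul
    (Complex.continuous_conj.comp (hx.continuous n)).continuousOn isCompact_Icc).re

/-- The energy balance of a single mode. -/
theorem mode_balance (hx : IsModeSolution a F ν ν' x) (ha : ∀ i, 0 < a i) (hF : 0 < F)
    (n : Fin 3 → ℤ) {t : ℝ} (ht : 0 ≤ t) :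
    ‖x t n‖ ^ 2 + 2 * ∫ τ in Set.Icc 0 t, symbolQG a F ν ν' n * ‖x τ n‖ ^ 2 =
      ‖x 0 n‖ ^ 2 -
        2 * ∫ τ in Set.Icc 0 t, (starRingEnd ℂ (x τ n) * nonlin a F (x τ) n).re := by
  have hN : IntervalIntegrable (fun τ => nonlin a F (x τ) n) volume 0 t := by
    rw [intervalIntegrable_iff_integrableOn_Icc_of_le ht]
    exact hx.integrable_nonlin ha hF n t
  have hσ : Continuous fun τ => (symbolQG a F ν ν' n : ℂ) * x τ n :=
    continuous_const.mul (hx.continuous n)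
  have h := norm_sq_eq_of_eq_integral (f := fun τ => x τ n) ht
    ((hσ.intervalIntegrable 0 t).add hN).neg (hx.continuous n) (fun s hs => by
      rw [hx.equation n s hs.1, sub_eq_add_neg, ← intervalIntegral.integral_neg]
      rfl)
  have h1 : IntervalIntegrable (fun τ => symbolQG a F ν ν' n * ‖x τ n‖ ^ 2) volume 0 t :=
    (continuous_const.mul ((hx.continuous n).norm.pow 2)).intervalIntegrable _ _
  have h2 : IntervalIntegrable (fun τ => (starRingEnd ℂ (x τ n) * nonlin a F (x τ) n).re)
      volume 0 t := by
    rw [intervalIntegrable_iff_integrableOn_Icc_of_le ht]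
    exact hx.integrable_transfer ha hF n t
  have h3 : ∫ τ in 0..t, (starRingEnd ℂ (x τ n) *
        (-fun τ => (symbolQG a F ν ν' n : ℂ) * x τ n + nonlin a F (x τ) n) τ).re =
      -((∫ τ in 0..t, symbolQG a F ν ν' n * ‖x τ n‖ ^ 2) +
        ∫ τ in 0..t, (starRingEnd ℂ (x τ n) * nonlin a F (x τ) n).re) := by
    rw [← intervalIntegral.integral_add h1 h2, ← intervalIntegral.integral_neg]
    congr 1
    funext τ
    rw [Pi.neg_apply, mul_neg, mul_add, mul_left_comm, Complex.conj_mul', Complex.neg_re,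
      Complex.add_re, ← Complex.ofReal_pow, ← Complex.ofReal_mul, Complex.ofReal_re]
  have h' : ‖x t n‖ ^ 2 = ‖x 0 n‖ ^ 2 + 2 * ∫ τ in 0..t, (starRingEnd ℂ (x τ n) *
        (-fun τ => (symbolQG a F ν ν' n : ℂ) * x τ n + nonlin a F (x τ) n) τ).re := h
  rw [h3] at h'
  rw [integral_Icc_eq_integral_Ioc, ← intervalIntegral.integral_of_le ht,
    integral_Icc_eq_integral_Ioc, ← intervalIntegral.integral_of_le ht]
  linarith

/-- The energy inequality of a single mode, with the dissipation bounded from below. -/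
theorem mode_le (hx : IsModeSolution a F ν ν' x) (ha : ∀ i, 0 < a i) (hF : 0 < F)
    (n : Fin 3 → ℤ) {t : ℝ} (ht : 0 ≤ t) :
    ‖x t n‖ ^ 2 + 2 * (min ν ν' * ∫ τ in Set.Icc 0 t, freqHSq a n * ‖x τ n‖ ^ 2) ≤
      ‖x 0 n‖ ^ 2 -
        2 * ∫ τ in Set.Icc 0 t, (starRingEnd ℂ (x τ n) * nonlin a F (x τ) n).re := by
  rw [← hx.mode_balance ha hF n ht, ← integral_const_mul]
  gcongr 2
  have hc : ∀ r : ℝ, Continuous fun τ => r * ‖x τ n‖ ^ 2 := fun r =>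
    continuous_const.mul ((hx.continuous n).norm.pow 2)
  apply integral_mono ((continuous_const.mul (hc _)).continuousOn.integrableOn_Icc)
    ((hc _).continuousOn.integrableOn_Icc)
  intro τ
  change min ν ν' * (freqHSq a n * ‖x τ n‖ ^ 2) ≤ symbolQG a F ν ν' n * ‖x τ n‖ ^ 2
  rw [← mul_assoc]
  gcongr
  exact symbolQG_lower_bound ha hF n

theorem ofReal_integral_freqHSq (hx : IsModeSolution a F ν ν' x) (n : Fin 3 → ℤ) (t : ℝ) :
    ENNReal.ofReal (∫ τ in Set.Icc 0 t, freqHSq a n * ‖x τ n‖ ^ 2) =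
      ∫⁻ τ in Set.Icc 0 t, (hNorm a n * ‖x τ n‖ₑ) ^ 2 := by
  rw [ofReal_integral_eq_lintegral_ofReal]
  · apply lintegral_congr
    intro τ
    rw [mul_pow, hNorm_sq, ENNReal.ofReal_mul (freqHSq_nonneg a n),
      ENNReal.ofReal_pow (norm_nonneg _), ofReal_norm]
  · exact (continuous_const.mul ((hx.continuous n).norm.pow 2)).continuousOn.integrableOn_Icc
  · exact Eventually.of_forall fun τ => mul_nonneg (freqHSq_nonneg a n) (sq_nonneg _)

/-- The energy inequality of a single mode, with the nonlinear term in absolute value. -/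
theorem mode_le_abs (hx : IsModeSolution a F ν ν' x) (ha : ∀ i, 0 < a i) (hF : 0 < F)
    (hν : 0 < ν) (hν' : 0 < ν') (n : Fin 3 → ℤ) {t : ℝ} (ht : 0 ≤ t) :
    ‖x t n‖ₑ ^ 2 + 2 * (ENNReal.ofReal (min ν ν') *
        ∫⁻ τ in Set.Icc 0 t, (hNorm a n * ‖x τ n‖ₑ) ^ 2) ≤
      ‖x 0 n‖ₑ ^ 2 + 2 * ∫⁻ τ in Set.Icc 0 t,
        ‖x τ n‖ₑ * (hNorm a n * convMajorant a F (fun k => ‖x τ k‖ₑ) n) := by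
  have hm : 0 < min ν ν' := lt_min hν hν'
  have h0 : 0 ≤ ∫ τ in Set.Icc 0 t, freqHSq a n * ‖x τ n‖ ^ 2 :=
    integral_nonneg fun τ => mul_nonneg (freqHSq_nonneg a n) (sq_nonneg _)
  rw [← hx.ofReal_integral_freqHSq, ← ofReal_norm, ← ofReal_norm, ← ENNReal.ofReal_mul hm.le,
    ← ENNReal.ofReal_pow (norm_nonneg _), ← ENNReal.ofReal_pow (norm_nonneg _),
    ← ENNReal.ofReal_ofNat, ← ENNReal.ofReal_mul (by norm_num),
    ← ENNReal.ofReal_add (by positivity) (by positivity)]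
  refine (ENNReal.ofReal_le_ofReal (hx.mode_le ha hF n ht)).trans ?_
  rw [sub_eq_add_neg, ← mul_neg]
  refine ENNReal.ofReal_add_le.trans ?_
  rw [ENNReal.ofReal_mul (by norm_num)]
  gcongr
  refine (ENNReal.ofReal_le_ofReal (neg_le_abs _)).trans ?_
  rw [← Real.norm_eq_abs, ofReal_norm]
  refine (enorm_integral_le_lintegral_enorm _).trans (lintegral_mono fun τ => ?_)
  calc ‖(starRingEnd ℂ (x τ n) * nonlin a F (x τ) n).re‖ₑ
      ≤ ‖starRingEnd ℂ (x τ n) * nonlin a F (x τ) n‖ₑ := by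
        rw [← ofReal_norm, ← ofReal_norm]
        exact ENNReal.ofReal_le_ofReal (Complex.abs_re_le_norm _)
    _ = ‖x τ n‖ₑ * ‖nonlin a F (x τ) n‖ₑ := by
        rw [enorm_mul, ← ofReal_norm, RCLike.norm_conj, ofReal_norm]
    _ ≤ _ := by
        gcongr
        exact enorm_nonlin_le a F (x τ) n

theorem lintegral_trilinear (hx : IsModeSolution a F ν ν' x) (lam : (Fin 3 → ℤ) → ℝ≥0∞)
    (T : ℝ) :
    ∫⁻ τ in Set.Icc 0 T, trilinear a F lam (fun k => ‖x τ k‖ₑ) =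
      ∑' n, lam n ^ 2 * ∫⁻ τ in Set.Icc 0 T,
        ‖x τ n‖ₑ * (hNorm a n * convMajorant a F (fun k => ‖x τ k‖ₑ) n) := by
  simp only [trilinear]
  rw [lintegral_tsum fun n => ((hx.measurable_trilinear_term n).const_mul _).aemeasurable]
  congr 1
  funext n
  rw [lintegral_const_mul _ (hx.measurable_trilinear_term n)]

theorem lintegral_wgrad (hx : IsModeSolution a F ν ν' x) (lam : (Fin 3 → ℤ) → ℝ≥0∞) (T : ℝ) :
    ∫⁻ τ in Set.Icc 0 T, ∑' n, (lam n * (hNorm a n * ‖x τ n‖ₑ)) ^ 2 =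
      ∑' n, lam n ^ 2 * ∫⁻ τ in Set.Icc 0 T, (hNorm a n * ‖x τ n‖ₑ) ^ 2 := by
  have hm : ∀ n, Measurable fun τ => (hNorm a n * ‖x τ n‖ₑ) ^ 2 := fun n =>
    ((hx.measurable_enorm n).const_mul _).pow_const 2
  simp only [mul_pow (lam _)]
  rw [lintegral_tsum fun n => ((hm n).const_mul _).aemeasurable]
  congr 1
  funext n
  rw [lintegral_const_mul _ (hm n)]

/-- The weighted energy inequality, without any cancellation in the nonlinear term. -/
theorem weighted_le (hx : IsModeSolution a F ν ν' x) (ha : ∀ i, 0 < a i) (hF : 0 < F)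
    (hν : 0 < ν) (hν' : 0 < ν') (lam : (Fin 3 → ℤ) → ℝ≥0∞) {t : ℝ} (ht : 0 ≤ t) :
    ∑' n, (lam n * ‖x t n‖ₑ) ^ 2 + 2 * (ENNReal.ofReal (min ν ν') *
        ∫⁻ τ in Set.Icc 0 t, ∑' n, (lam n * (hNorm a n * ‖x τ n‖ₑ)) ^ 2) ≤
      ∑' n, (lam n * ‖x 0 n‖ₑ) ^ 2 +
        2 * ∫⁻ τ in Set.Icc 0 t, trilinear a F lam (fun k => ‖x τ k‖ₑ) := by
  rw [hx.lintegral_wgrad, hx.lintegral_trilinear, ← ENNReal.tsum_mul_left,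
    ← ENNReal.tsum_mul_left, ← ENNReal.tsum_mul_left, ← ENNReal.tsum_add, ← ENNReal.tsum_add]
  refine ENNReal.tsum_le_tsum fun n => ?_
  calc _ = lam n ^ 2 * (‖x t n‖ₑ ^ 2 + 2 * (ENNReal.ofReal (min ν ν') *
        ∫⁻ τ in Set.Icc 0 t, (hNorm a n * ‖x τ n‖ₑ) ^ 2)) := by ring
    _ ≤ lam n ^ 2 * _ := mul_le_mul_right (hx.mode_le_abs ha hF hν hν' n ht) _
    _ = _ := by ring

/-- Finiteness of the time integral of the weighted trilinear form. -/
theorem lintegral_trilinear_ne_top (hx : IsModeSolution a F ν ν' x) (ha : ∀ i, 0 < a i)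
    (hF : 0 < F) {lam : (Fin 3 → ℤ) → ℝ≥0∞} {Cs : ℝ≥0∞} (hCs : Cs ≠ ⊤)
    (hlam : ∀ n k, lam n ≤ Cs * (lam k + lam (n - k))) {T : ℝ} {M : ℝ≥0∞} (hM : M ≠ ⊤)
    (hb : ∀ t ∈ Set.Icc 0 T, ∑' n, (lam n * ‖x t n‖ₑ) ^ 2 ≤ M)
    (hg : ∫⁻ τ in Set.Icc 0 T, ∑' n, (lam n * (hNorm a n * ‖x τ n‖ₑ)) ^ 2 ≠ ⊤) :
    ∫⁻ τ in Set.Icc 0 T, trilinear a F lam (fun k => ‖x τ k‖ₑ) ≠ ⊤ := by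
  obtain ⟨K, hK, htri⟩ := exists_trilinear_bound ha hF
  have hle : ∫⁻ τ in Set.Icc 0 T, trilinear a F lam (fun k => ‖x τ k‖ₑ) ≤
      ∫⁻ τ in Set.Icc 0 T, (∑' n, (lam n * (hNorm a n * ‖x τ n‖ₑ)) ^ 2 +
        ENNReal.ofReal K * Cs ^ 2 * (M * ∑' n, (hNorm a n * ‖x τ n‖ₑ) ^ 2)) := by
    apply setLIntegral_mono (by
      exact (hx.measurable_wgrad lam).add
        (((hx.measurable_wsum (hNorm a)).const_mul _).const_mul _))
    intro τ hτ
    have h1 := htri lam Cs hlam (fun k => ‖x τ k‖ₑ) 1 one_pos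
    rw [inv_one, ENNReal.ofReal_one, one_mul, one_mul] at h1
    calc trilinear a F lam (fun k => ‖x τ k‖ₑ)
        ≤ 2 * trilinear a F lam (fun k => ‖x τ k‖ₑ) := le_mul_of_one_le_left' (by norm_num)
      _ ≤ _ := h1
      _ ≤ _ := by
          gcongr
          exact hb τ hτ
  refine ne_top_of_le_ne_top ?_ hle
  rw [lintegral_add_left (hx.measurable_wgrad lam),
    lintegral_const_mul _ ((hx.measurable_wsum (hNorm a)).const_mul _),
    lintegral_const_mul _ (hx.measurable_wsum (hNorm a))]
  refine ENNReal.add_ne_top.mpr ⟨hg, ENNReal.mul_ne_top ?_ (ENNReal.mul_ne_top hM (hx.gradient T))⟩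
  exact ENNReal.mul_ne_top ENNReal.ofReal_ne_top (ENNReal.pow_ne_top hCs)

/-- The energy inequality in `L²`, where the nonlinear term disappears. -/
theorem energy_le (hx : IsModeSolution a F ν ν' x) (ha : ∀ i, 0 < a i) (hF : 0 < F)
    (hν : 0 < ν) (hν' : 0 < ν') {t : ℝ} (ht : 0 ≤ t) :
    ∑' n, ‖x t n‖ₑ ^ 2 + 2 * (ENNReal.ofReal (min ν ν') *
        ∫⁻ τ in Set.Icc 0 t, ∑' n, (hNorm a n * ‖x τ n‖ₑ) ^ 2) ≤ ∑' n, ‖x 0 n‖ₑ ^ 2 := by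
  have hm : 0 < min ν ν' := lt_min hν hν'
  obtain ⟨M, hM, hb⟩ := hx.bounded t
  have htri : ∫⁻ τ in Set.Icc 0 t, trilinear a F 1 (fun k => ‖x τ k‖ₑ) ≠ ⊤ :=
    hx.lintegral_trilinear_ne_top ha hF (Cs := 1) (by simp) (fun n k => by simp) hM
      (by simpa using hb) (by simpa using hx.gradient t)
  have htrim : Measurable fun τ => trilinear a F 1 (fun k => ‖x τ k‖ₑ) :=
    Measurable.tsum fun n => (hx.measurable_trilinear_term n).const_mul _
  set q : (Fin 3 → ℤ) → ℝ → ℝ := fun n τ =>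
    (starRingEnd ℂ (x τ n) * nonlin a F (x τ) n).re with hq
  have hqle : ∀ n τ, ‖q n τ‖ₑ ≤
      ‖x τ n‖ₑ * (hNorm a n * convMajorant a F (fun k => ‖x τ k‖ₑ) n) := by
    intro n τ
    calc ‖q n τ‖ₑ ≤ ‖starRingEnd ℂ (x τ n) * nonlin a F (x τ) n‖ₑ := by
          rw [← ofReal_norm, ← ofReal_norm]
          exact ENNReal.ofReal_le_ofReal (Complex.abs_re_le_norm _)
      _ = ‖x τ n‖ₑ * ‖nonlin a F (x τ) n‖ₑ := by
          rw [enorm_mul, ← ofReal_norm, RCLike.norm_conj, ofReal_norm]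
      _ ≤ _ := by
          gcongr
          exact enorm_nonlin_le a F (x τ) n
  have hsummable : Summable fun n => ∫ τ in Set.Icc 0 t, ‖q n τ‖ := by
    apply Summable.of_enorm
    refine ne_top_of_le_ne_top htri ?_
    rw [hx.lintegral_trilinear]
    refine ENNReal.tsum_le_tsum fun n => ?_
    rw [Pi.one_apply, one_pow, one_mul]
    refine (enorm_integral_le_lintegral_enorm _).trans (lintegral_mono fun τ => ?_)
    rw [enorm_norm]
    exact hqle n τ
  have hqsum := hasSum_integral_of_summable_integral_norm (F := q)
    (μ := volume.restrict (Set.Icc 0 t)) (fun n => hx.integrable_transfer ha hF n t) hsummable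
  have hzero : ∫ τ in Set.Icc 0 t, ∑' n, q n τ = 0 := by
    apply integral_eq_zero_of_ae
    filter_upwards [ae_lt_top htrim htri, ae_restrict_mem measurableSet_Icc] with τ hτ hτt
    exact (hasSum_nonlin_eq_zero (hx.hermitian τ hτt.1) hτ.ne).tsum_eq
  rw [hzero] at hqsum
  have h0 : ∑' n, ‖x 0 n‖ₑ ^ 2 ≠ ⊤ := ne_top_of_le_ne_top hM (hb 0 ⟨le_rfl, ht⟩)
  have hs0 : Summable fun n => ‖x 0 n‖ ^ 2 := by
    apply Summable.of_enorm
    simpa [enorm_pow] using h0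
  have hrhs := hs0.hasSum.sub (hqsum.mul_left 2)
  rw [mul_zero, sub_zero] at hrhs
  have hnn : ∀ n, 0 ≤ ‖x t n‖ ^ 2 +
      2 * (min ν ν' * ∫ τ in Set.Icc 0 t, freqHSq a n * ‖x τ n‖ ^ 2) := by
    intro n
    have h0 : 0 ≤ ∫ τ in Set.Icc 0 t, freqHSq a n * ‖x τ n‖ ^ 2 :=
      integral_nonneg fun τ => mul_nonneg (freqHSq_nonneg a n) (sq_nonneg _)
    positivity
  have hle := fun n => hx.mode_le ha hF n ht
  have hlhs : Summable fun n => ‖x t n‖ ^ 2 +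
      2 * (min ν ν' * ∫ τ in Set.Icc 0 t, freqHSq a n * ‖x τ n‖ ^ 2) :=
    Summable.of_nonneg_of_le hnn hle hrhs.summable
  have hfin := ENNReal.ofReal_le_ofReal ((hlhs.tsum_le_tsum hle hrhs.summable).trans_eq
    hrhs.tsum_eq)
  rw [ENNReal.ofReal_tsum_of_nonneg hnn hlhs,
    ENNReal.ofReal_tsum_of_nonneg (fun n => sq_nonneg _) hs0] at hfin
  have e1 : ∫⁻ τ in Set.Icc 0 t, ∑' n, (hNorm a n * ‖x τ n‖ₑ) ^ 2 =
      ∑' n, ∫⁻ τ in Set.Icc 0 t, (hNorm a n * ‖x τ n‖ₑ) ^ 2 :=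
    lintegral_tsum fun n => (((hx.measurable_enorm n).const_mul _).pow_const 2).aemeasurable
  rw [e1, ← ENNReal.tsum_mul_left, ← ENNReal.tsum_mul_left, ← ENNReal.tsum_add]
  refine le_trans (le_of_eq (tsum_congr fun n => ?_))
    (hfin.trans (le_of_eq (tsum_congr fun n => ?_)))
  · have h0 : 0 ≤ ∫ τ in Set.Icc 0 t, freqHSq a n * ‖x τ n‖ ^ 2 :=
      integral_nonneg fun τ => mul_nonneg (freqHSq_nonneg a n) (sq_nonneg _)
    rw [← hx.ofReal_integral_freqHSq, ENNReal.ofReal_add (by positivity) (by positivity),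
      ENNReal.ofReal_mul (by norm_num), ENNReal.ofReal_mul hm.le,
      ENNReal.ofReal_pow (norm_nonneg _), ofReal_norm, ENNReal.ofReal_ofNat]
  · rw [ENNReal.ofReal_pow (norm_nonneg _), ofReal_norm]

end IsModeSolution

/-! ### Weighted bounds and continuity in time -/

/-- Grönwall's inequality for functions with values in `[0, ∞]`. -/
theorem lintegral_gronwall {g y : ℝ → ℝ≥0∞} {A M : ℝ≥0∞} {T : ℝ} (hT : 0 ≤ T)
    (hgm : Measurable g) (hym : Measurable y) (hA : A ≠ ⊤) (hM : M ≠ ⊤)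
    (hg : ∫⁻ t in Set.Icc 0 T, g t ≠ ⊤) (hy : ∀ t ∈ Set.Icc 0 T, y t ≤ M)
    (h : ∀ t ∈ Set.Icc 0 T, y t ≤ A + ∫⁻ τ in Set.Icc 0 t, g τ * y τ) :
    A + ∫⁻ τ in Set.Icc 0 T, g τ * y τ ≤
      A * ENNReal.ofReal (Real.exp (2 * (∫⁻ τ in Set.Icc 0 T, g τ).toReal)) := by
  have hgy : ∫⁻ t in Set.Icc 0 T, g t * y t ≠ ⊤ := by
    have : ∫⁻ t in Set.Icc 0 T, g t * y t ≤ ∫⁻ t in Set.Icc 0 T, g t * M := by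
      apply setLIntegral_mono (hgm.mul_const M)
      intro t ht
      gcongr
      exact hy t ht
    rw [lintegral_mul_const _ hgm] at this
    exact ne_top_of_le_ne_top (ENNReal.mul_ne_top hg hM) this
  have hgym : Measurable fun t => g t * y t := hgm.mul hym
  have hcut : ∀ {f : ℝ → ℝ≥0∞} {t : ℝ}, t ≤ T → ∫⁻ τ in Set.Icc 0 T, f τ ≠ ⊤ →
      ∫⁻ τ in Set.Icc 0 t, f τ ≠ ⊤ := fun ht hf =>
    ne_top_of_le_ne_top hf (lintegral_mono_set (Set.Icc_subset_Icc le_rfl ht))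
  have hreal : ∀ {f : ℝ → ℝ≥0∞} {t : ℝ}, Measurable f → 0 ≤ t →
      ∫⁻ τ in Set.Icc 0 t, f τ ≠ ⊤ →
      ∫ τ in 0..t, (f τ).toReal = (∫⁻ τ in Set.Icc 0 t, f τ).toReal := by
    intro f t hf ht hfin
    rw [intervalIntegral.integral_of_le ht, ← integral_Icc_eq_integral_Ioc,
      integral_toReal hf.aemeasurable (ae_lt_top hf hfin)]
  have key := gronwall_integral (g := fun t => (g t).toReal) (y := fun t => (y t).toReal)
    (A := A.toReal) ENNReal.toReal_nonneg hT
    (integrable_toReal_of_lintegral_ne_top hgm.aemeasurable hg)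
    (fun t => ENNReal.toReal_nonneg)
    (by
      simp only [← ENNReal.toReal_mul]
      exact integrable_toReal_of_lintegral_ne_top (hgm.mul hym).aemeasurable hgy)
    (fun t => ENNReal.toReal_nonneg)
    (fun t ht => by
      simp only [← ENNReal.toReal_mul]
      rw [hreal hgym ht.1 (hcut ht.2 hgy), ← ENNReal.toReal_add hA (hcut ht.2 hgy)]
      exact ENNReal.toReal_mono (ENNReal.add_ne_top.mpr ⟨hA, hcut ht.2 hgy⟩) (h t ht))
  simp only [← ENNReal.toReal_mul] at key
  rw [hreal hgym hT hgy, hreal hgm hT hg, ← ENNReal.toReal_add hA hgy] at key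
  have := ENNReal.ofReal_le_ofReal key
  rwa [ENNReal.ofReal_toReal (ENNReal.add_ne_top.mpr ⟨hA, hgy⟩),
    ENNReal.ofReal_mul ENNReal.toReal_nonneg, ENNReal.ofReal_toReal hA] at this

/-- The weighted estimate for bounded weights, for which every quantity is known to be finite. -/
theorem exists_bounded_weight_bound {a : Fin 3 → ℝ} (ha : ∀ i, 0 < a i) {F ν ν' : ℝ} (hF : 0 < F)
    (hν : 0 < ν) (hν' : 0 < ν') :
    ∃ K : ℝ, 0 < K ∧ ∀ (lam : (Fin 3 → ℤ) → ℝ≥0∞) (N : ℝ≥0∞) (Cs : ℝ), N ≠ ⊤ → 0 ≤ Cs →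
      (∀ n, lam n ≤ N) → (∀ n k, lam n ≤ ENNReal.ofReal Cs * (lam k + lam (n - k))) →
      ∀ x : ℝ → (Fin 3 → ℤ) → ℂ, IsModeSolution a F ν ν' x → ∀ t, 0 ≤ t →
      ∑' n, (lam n * ‖x t n‖ₑ) ^ 2 + ENNReal.ofReal (min ν ν') *
          ∫⁻ τ in Set.Icc 0 t, ∑' n, (lam n * (hNorm a n * ‖x τ n‖ₑ)) ^ 2 ≤
        (∑' n, (lam n * ‖x 0 n‖ₑ) ^ 2) *
          ENNReal.ofReal (Real.exp (K * Cs ^ 2 * (∑' n, ‖x 0 n‖ₑ ^ 2).toReal)) := by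
  obtain ⟨K, hK, htri⟩ := exists_trilinear_bound ha hF
  have hm : 0 < min ν ν' := lt_min hν hν'
  set c := min ν ν' with hc
  refine ⟨K / c ^ 2, by positivity, fun lam N Cs hN hCs hlamN hlam x hx t ht => ?_⟩
  set D : ℝ → ℝ≥0∞ := fun τ => ∑' n, (hNorm a n * ‖x τ n‖ₑ) ^ 2 with hD
  set E : ℝ → ℝ≥0∞ := fun τ => ∑' n, (lam n * ‖x τ n‖ₑ) ^ 2 with hE
  set H : ℝ → ℝ≥0∞ := fun τ => ∑' n, (lam n * (hNorm a n * ‖x τ n‖ₑ)) ^ 2 with hH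
  set e : ℝ≥0∞ := ∑' n, ‖x 0 n‖ₑ ^ 2 with he
  have hDm : Measurable D := hx.measurable_wsum _
  have hEm : Measurable E := hx.measurable_wsum _
  have hHm : Measurable H := hx.measurable_wgrad _
  obtain ⟨M, hM, hb⟩ := hx.bounded t
  have hEM : ∀ τ ∈ Set.Icc 0 t, E τ ≤ N ^ 2 * M := by
    intro τ hτ
    refine le_trans ?_ (mul_le_mul_right (hb τ hτ) _)
    rw [← ENNReal.tsum_mul_left]
    refine ENNReal.tsum_le_tsum fun n => ?_
    rw [mul_pow]
    gcongr
    exact hlamN n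
  have hNM : N ^ 2 * M ≠ ⊤ := ENNReal.mul_ne_top (ENNReal.pow_ne_top hN) hM
  have hHD : ∀ τ, H τ ≤ N ^ 2 * D τ := by
    intro τ
    rw [hD, ← ENNReal.tsum_mul_left]
    refine ENNReal.tsum_le_tsum fun n => ?_
    rw [mul_pow]
    gcongr
    exact hlamN n
  have hHfin : ∀ s ≤ t, ∫⁻ τ in Set.Icc 0 s, H τ ≠ ⊤ := by
    intro s hs
    refine ne_top_of_le_ne_top ?_ (lintegral_mono hHD)
    rw [lintegral_const_mul _ hDm]
    exact ENNReal.mul_ne_top (ENNReal.pow_ne_top hN) (hx.gradient s)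
  set B : ℝ≥0∞ := ENNReal.ofReal c⁻¹ * (ENNReal.ofReal K * ENNReal.ofReal Cs ^ 2) with hB
  have hBfin : B ≠ ⊤ := ENNReal.mul_ne_top ENNReal.ofReal_ne_top
    (ENNReal.mul_ne_top ENNReal.ofReal_ne_top (ENNReal.pow_ne_top ENNReal.ofReal_ne_top))
  have hineq : ∀ s ∈ Set.Icc 0 t, E s + ENNReal.ofReal c * ∫⁻ τ in Set.Icc 0 s, H τ ≤
      E 0 + ∫⁻ τ in Set.Icc 0 s, (B * D τ) * E τ := by
    intro s hs
    have h1 := hx.weighted_le ha hF hν hν' lam hs.1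
    have h2 : 2 * ∫⁻ τ in Set.Icc 0 s, trilinear a F lam (fun k => ‖x τ k‖ₑ) ≤
        ENNReal.ofReal c * (∫⁻ τ in Set.Icc 0 s, H τ) + ∫⁻ τ in Set.Icc 0 s, (B * D τ) * E τ := by
      rw [← lintegral_const_mul' _ _ (by simp), ← lintegral_const_mul _ hHm,
        ← lintegral_add_left (hHm.const_mul _)]
      refine lintegral_mono fun τ => (htri lam _ hlam _ c hm).trans (le_of_eq ?_)
      simp only [hB, hE, hD, hH]
      ring
    have h3 := h1.trans (add_le_add_right h2 _)
    have hcH : ENNReal.ofReal c * ∫⁻ τ in Set.Icc 0 s, H τ ≠ ⊤ :=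
      ENNReal.mul_ne_top ENNReal.ofReal_ne_top (hHfin s hs.2)
    refine (ENNReal.add_le_add_iff_right hcH).mp ?_
    calc _ = E s + 2 * (ENNReal.ofReal c * ∫⁻ τ in Set.Icc 0 s, H τ) := by ring
      _ ≤ _ := h3
      _ = _ := by ring
  have hE0 : E 0 ≠ ⊤ := ne_top_of_le_ne_top hNM (hEM 0 ⟨le_rfl, ht⟩)
  have hBD : ∫⁻ τ in Set.Icc 0 t, B * D τ ≠ ⊤ := by
    rw [lintegral_const_mul _ hDm]
    exact ENNReal.mul_ne_top hBfin (hx.gradient t)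
  have hG := lintegral_gronwall ht (hDm.const_mul B) hEm hE0 hNM hBD hEM
    (fun s hs => le_self_add.trans (hineq s hs))
  refine ((hineq t ⟨ht, le_rfl⟩).trans hG).trans ?_
  gcongr E 0 * ENNReal.ofReal (Real.exp ?_)
  have he' : e ≠ ⊤ := ne_top_of_le_ne_top hM (hb 0 ⟨le_rfl, ht⟩)
  have hen := ENNReal.toReal_mono he'
    ((le_add_self).trans (hx.energy_le ha hF hν hν' ht))
  rw [ENNReal.toReal_mul, ENNReal.toReal_mul, ENNReal.toReal_ofReal hm.le,
    ENNReal.toReal_ofNat] at hen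
  rw [lintegral_const_mul _ hDm, ENNReal.toReal_mul, hB, ENNReal.toReal_mul, ENNReal.toReal_mul,
    ENNReal.toReal_pow, ENNReal.toReal_ofReal (by positivity), ENNReal.toReal_ofReal hK.le,
    ENNReal.toReal_ofReal hCs]
  calc 2 * (c⁻¹ * (K * Cs ^ 2) * (∫⁻ τ in Set.Icc 0 t, D τ).toReal)
      = K / c ^ 2 * Cs ^ 2 * (2 * (c * (∫⁻ τ in Set.Icc 0 t, D τ).toReal)) := by
        field_simp
    _ ≤ _ := by gcongr

theorem ennreal_tsum_le_of_sum_le {ι : Type*} {f : ι → ℝ≥0∞} {b : ℝ≥0∞}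
    (h : ∀ S : Finset ι, ∑ i ∈ S, f i ≤ b) : ∑' i, f i ≤ b := by
  rw [ENNReal.tsum_eq_iSup_sum]
  exact iSup_le h

/-- The weighted estimate for arbitrary weights, by truncation. -/
theorem exists_weight_bound {a : Fin 3 → ℝ} (ha : ∀ i, 0 < a i) {F ν ν' : ℝ} (hF : 0 < F)
    (hν : 0 < ν) (hν' : 0 < ν') :
    ∃ K : ℝ, 0 < K ∧ ∀ (lam : (Fin 3 → ℤ) → ℝ≥0∞) (Cs : ℝ), 1 ≤ Cs → (∀ n, lam n ≠ ⊤) →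
      (∀ n k, lam n ≤ ENNReal.ofReal Cs * (lam k + lam (n - k))) →
      ∀ x : ℝ → (Fin 3 → ℤ) → ℂ, IsModeSolution a F ν ν' x → ∀ t, 0 ≤ t →
      ∑' n, (lam n * ‖x t n‖ₑ) ^ 2 + ENNReal.ofReal (min ν ν') *
          ∫⁻ τ in Set.Icc 0 t, ∑' n, (lam n * (hNorm a n * ‖x τ n‖ₑ)) ^ 2 ≤
        (∑' n, (lam n * ‖x 0 n‖ₑ) ^ 2) *
          ENNReal.ofReal (Real.exp (K * Cs ^ 2 * (∑' n, ‖x 0 n‖ₑ ^ 2).toReal)) := by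
  obtain ⟨K, hK, hbd⟩ := exists_bounded_weight_bound ha (F := F) hF hν hν'
  refine ⟨K, hK, fun lam Cs hCs hfin hlam x hx t ht => ?_⟩
  rw [hx.lintegral_wgrad, ← ENNReal.tsum_mul_left, ← ENNReal.tsum_add]
  refine ennreal_tsum_le_of_sum_le fun S => ?_
  -- on the modes of `S`, the weight `lam` coincides with its truncation at height `N`
  set N : ℝ≥0∞ := ∑ n ∈ S, lam n with hN
  have hNtop : N ≠ ⊤ := ENNReal.sum_ne_top.mpr fun n _ => hfin n
  set μ : (Fin 3 → ℤ) → ℝ≥0∞ := fun n => min (lam n) N with hμ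
  have hμS : ∀ n ∈ S, μ n = lam n := fun n hn =>
    min_eq_left (Finset.single_le_sum (f := lam) (fun _ _ => zero_le) hn)
  have hCs1 : 1 ≤ ENNReal.ofReal Cs := by rwa [ENNReal.one_le_ofReal]
  have hμsub : ∀ n k, μ n ≤ ENNReal.ofReal Cs * (μ k + μ (n - k)) := by
    intro n k
    have hbig : ∀ z, N ≤ z → N ≤ ENNReal.ofReal Cs * z := fun z hz =>
      hz.trans (le_mul_of_one_le_left' hCs1)
    rcases le_total (lam k) N with h1 | h1
    · rcases le_total (lam (n - k)) N with h2 | h2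
      · simp only [hμ, min_eq_left h1, min_eq_left h2]
        exact (min_le_left _ _).trans (hlam n k)
      · simp only [hμ, min_eq_right h2]
        exact (min_le_right _ _).trans (hbig _ le_add_self)
    · simp only [hμ, min_eq_right h1]
      exact (min_le_right _ _).trans (hbig _ le_self_add)
  have h := hbd μ N Cs hNtop (by linarith) (fun n => min_le_right _ _) hμsub x hx t ht
  rw [hx.lintegral_wgrad, ← ENNReal.tsum_mul_left, ← ENNReal.tsum_add] at h
  calc _ = ∑ n ∈ S, ((μ n * ‖x t n‖ₑ) ^ 2 + ENNReal.ofReal (min ν ν') *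
        (μ n ^ 2 * ∫⁻ τ in Set.Icc 0 t, (hNorm a n * ‖x τ n‖ₑ) ^ 2)) :=
        Finset.sum_congr rfl fun n hn => by rw [hμS n hn]
    _ ≤ _ := ENNReal.sum_le_tsum S
    _ ≤ _ := h
    _ ≤ _ := by
        gcongr
        exact min_le_left _ _

/-- Continuity in time for a weighted norm: the modes are continuous, and the mode-wise energy
inequality bounds them by a convergent series that does not depend on time. -/
theorem IsModeSolution.tendsto_weighted {a : Fin 3 → ℝ} (ha : ∀ i, 0 < a i) {F ν ν' : ℝ}
    (hF : 0 < F) (hν : 0 < ν) (hν' : 0 < ν') {lam : (Fin 3 → ℤ) → ℝ≥0∞} {Cs : ℝ} (hCs : 1 ≤ Cs)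
    (hfin : ∀ n, lam n ≠ ⊤) (hlam : ∀ n k, lam n ≤ ENNReal.ofReal Cs * (lam k + lam (n - k)))
    {x : ℝ → (Fin 3 → ℤ) → ℂ} (hx : IsModeSolution a F ν ν' x)
    (h0 : ∑' n, (lam n * ‖x 0 n‖ₑ) ^ 2 ≠ ⊤) {t₀ : ℝ} (ht₀ : 0 ≤ t₀) :
    Tendsto (fun t => ∑' n, (lam n * ‖x t n - x t₀ n‖ₑ) ^ 2) (𝓝[Set.Ici 0] t₀) (𝓝 0) := by
  obtain ⟨K, hK, hbd⟩ := exists_weight_bound ha hF hν hν'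
  set T := t₀ + 1 with hT
  set R := (∑' n, (lam n * ‖x 0 n‖ₑ) ^ 2) *
    ENNReal.ofReal (Real.exp (K * Cs ^ 2 * (∑' n, ‖x 0 n‖ₑ ^ 2).toReal)) with hR
  have hRfin : R ≠ ⊤ := ENNReal.mul_ne_top h0 ENNReal.ofReal_ne_top
  have hbound := fun t ht => hbd lam Cs hCs hfin hlam x hx t ht
  have hgrad : ∫⁻ τ in Set.Icc 0 T, ∑' n, (lam n * (hNorm a n * ‖x τ n‖ₑ)) ^ 2 ≠ ⊤ := by
    have h1 := ne_top_of_le_ne_top hRfin (le_add_self.trans (hbound T (by positivity)))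
    intro htop
    rw [htop, ENNReal.mul_top (by simpa using lt_min hν hν')] at h1
    exact h1 rfl
  have htri := hx.lintegral_trilinear_ne_top ha hF ENNReal.ofReal_ne_top hlam hRfin
    (fun t ht => le_self_add.trans (hbound t ht.1)) hgrad
  set J : (Fin 3 → ℤ) → ℝ≥0∞ := fun n => ∫⁻ τ in Set.Icc 0 T,
    ‖x τ n‖ₑ * (hNorm a n * convMajorant a F (fun k => ‖x τ k‖ₑ) n) with hJ
  set b : (Fin 3 → ℤ) → ℝ≥0∞ := fun n => lam n ^ 2 * (‖x 0 n‖ₑ ^ 2 + 2 * J n) with hb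
  have hbsum : ∑' n, b n ≠ ⊤ := by
    have : ∑' n, b n = ∑' n, (lam n * ‖x 0 n‖ₑ) ^ 2 +
        2 * ∫⁻ τ in Set.Icc 0 T, trilinear a F lam (fun k => ‖x τ k‖ₑ) := by
      rw [hx.lintegral_trilinear, ← ENNReal.tsum_mul_left, ← ENNReal.tsum_add]
      refine tsum_congr fun n => ?_
      simp only [hb, hJ]
      ring
    rw [this]
    exact ENNReal.add_ne_top.mpr ⟨h0, ENNReal.mul_ne_top (by simp) htri⟩
  have hmode : ∀ n, ∀ t ∈ Set.Icc 0 T, (lam n * ‖x t n‖ₑ) ^ 2 ≤ b n := by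
    intro n t ht
    rw [mul_pow]
    simp only [hb]
    gcongr
    refine (le_self_add.trans (hx.mode_le_abs ha hF hν hν' n ht.1)).trans ?_
    gcongr
    exact lintegral_mono_set (Set.Icc_subset_Icc le_rfl ht.2)
  have hdiff : ∀ n, ∀ t ∈ Set.Icc 0 T, (lam n * ‖x t n - x t₀ n‖ₑ) ^ 2 ≤ 4 * b n := by
    intro n t ht
    have h1 : lam n * ‖x t n - x t₀ n‖ₑ ≤ lam n * ‖x t n‖ₑ + lam n * ‖x t₀ n‖ₑ := by
      rw [← mul_add]
      gcongr
      exact enorm_sub_le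
    have h2 := ENNReal.rpow_add_le_mul_rpow_add_rpow (lam n * ‖x t n‖ₑ) (lam n * ‖x t₀ n‖ₑ)
      (p := 2) (by norm_num)
    norm_num at h2
    calc _ ≤ (lam n * ‖x t n‖ₑ + lam n * ‖x t₀ n‖ₑ) ^ 2 := by gcongr
      _ ≤ 2 * ((lam n * ‖x t n‖ₑ) ^ 2 + (lam n * ‖x t₀ n‖ₑ) ^ 2) := h2
      _ ≤ 2 * (b n + b n) := by
          gcongr
          · exact hmode n t ht
          · exact hmode n t₀ ⟨ht₀, by linarith⟩
      _ = 4 * b n := by ring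
  let _ : MeasurableSpace (Fin 3 → ℤ) := ⊤
  have hlim := tendsto_lintegral_filter_of_dominated_convergence
    (μ := (Measure.count : Measure (Fin 3 → ℤ))) (l := 𝓝[Set.Ici 0] t₀)
    (F := fun t n => (lam n * ‖x t n - x t₀ n‖ₑ) ^ 2) (f := fun _ => 0) (fun n => 4 * b n)
    (Eventually.of_forall fun t => measurable_from_top) ?_ ?_ ?_
  · simpa only [lintegral_count, tsum_zero] using hlim
  · have : ∀ᶠ t in 𝓝[Set.Ici 0] t₀, t ∈ Set.Icc 0 T := by
      filter_upwards [self_mem_nhdsWithin,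
        mem_nhdsWithin_of_mem_nhds (Iic_mem_nhds (show t₀ < T by linarith))] with t h1 h2
      exact ⟨h1, h2⟩
    filter_upwards [this] with t ht
    exact Eventually.of_forall fun n => hdiff n t ht
  · rw [lintegral_count, ENNReal.tsum_mul_left]
    exact ENNReal.mul_ne_top (by simp) hbsum
  · refine Eventually.of_forall fun n => ?_
    have hc : Tendsto (fun t => x t n - x t₀ n) (𝓝[Set.Ici 0] t₀) (𝓝 0) := by
      have := ((hx.continuous n).tendsto t₀).sub_const (x t₀ n)
      rw [sub_self] at this
      exact this.mono_left nhdsWithin_le_nhds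
    have h1 := ENNReal.Tendsto.const_mul (a := lam n) hc.enorm (Or.inr (hfin n))
    have h2 := ENNReal.Tendsto.pow (n := 2) h1
    simpa using h2

/-! ### The weak formulation, tested with exponentials -/

/-- The symbols of the velocity in terms of `Ω` are bounded, as `|ň_h| / |ň|_F²` is. -/
theorem freqHSq_mul_inv_sq_bounded {a : Fin 3 → ℝ} (ha : ∀ i, 0 < a i) {F : ℝ} (hF : 0 < F) :
    ∃ B : ℝ, 0 ≤ B ∧ ∀ n, freqHSq a n * ((freqFSq a F n)⁻¹) ^ 2 ≤ B := by
  obtain ⟨K, hK, hb⟩ := exists_inv_freqFSq_sq_le ha hF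
  have hT : 0 ≤ ∑' n, latticeWeight n := tsum_nonneg latticeWeight_nonneg
  refine ⟨1 + K * ∑' n, latticeWeight n, by positivity, fun n => ?_⟩
  set p := (freqFSq a F n)⁻¹ with hp
  have hp0 : 0 ≤ p := inv_nonneg.mpr (freqFSq_nonneg a F n)
  have h1 : freqHSq a n * p ≤ 1 := by
    rw [hp, ← div_eq_mul_inv]
    apply div_le_one_of_le₀ _ (freqFSq_nonneg a F n)
    rw [freqFSq]
    have : 0 ≤ F ^ 2 * freq a n 2 ^ 2 := by positivity
    linarith
  have h2 : p ^ 2 ≤ K * ∑' n, latticeWeight n := (hb n).trans (by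
    gcongr
    exact summable_latticeWeight.le_tsum n fun j _ => latticeWeight_nonneg j)
  nlinarith [mul_le_mul_of_nonneg_right h1 hp0, sq_nonneg (p - 1)]

/-- The operators `± ∂ᵢ Δ_F⁻¹` map `L²` to itself, with the expected Fourier coefficients. -/
theorem exists_velocity_aux {a : Fin 3 → ℝ} (ha : ∀ i, 0 < a i) {F : ℝ} (hF : 0 < F) (i : Fin 3)
    (hi : i = 0 ∨ i = 1) (ε : ℝ) (hε : ε ^ 2 = 1) (u : L2) :
    ∃ w : L2, (∀ n, coeff w n =
        (ε : ℂ) * (Complex.I * freq a n i) * invLaplaceF a F n * coeff u n) ∧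
      multiplier (fun n => (ε : ℂ) * (Complex.I * freq a n i) * invLaplaceF a F n) u
        =ᵐ[torusMeasure] w := by
  obtain ⟨B, hB, hbd⟩ := freqHSq_mul_inv_sq_bounded ha hF
  apply exists_multiplier
  · intro n
    simp only [freq_neg, invLaplaceF, freqFSq_neg, map_mul, Complex.conj_ofReal, Complex.conj_I]
    push_cast
    ring
  · refine Summable.of_nonneg_of_le (fun n => sq_nonneg _) (fun n => ?_)
      ((hasSum_sq_coeff u).summable.mul_left B)
    rw [norm_mul, mul_pow]
    gcongr
    rw [norm_mul, norm_mul, norm_mul, Complex.norm_I, one_mul, Complex.norm_real,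
      Complex.norm_real, Complex.norm_real, mul_pow, mul_pow, Real.norm_eq_abs, Real.norm_eq_abs,
      Real.norm_eq_abs, sq_abs, sq_abs, sq_abs, hε, one_mul, invLaplaceF, neg_sq, one_div]
    refine le_trans ?_ (hbd n)
    gcongr
    rw [freqHSq]
    rcases hi with rfl | rfl
    · linarith [sq_nonneg (freq a n 1)]
    · linarith [sq_nonneg (freq a n 0)]

theorem exists_velocity₁ {a : Fin 3 → ℝ} (ha : ∀ i, 0 < a i) {F : ℝ} (hF : 0 < F) (u : L2) :
    ∃ w : L2, (∀ n, coeff w n =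
        Complex.I * freq a n 1 * ((freqFSq a F n)⁻¹ : ℝ) * coeff u n) ∧
      velocity₁ a F u =ᵐ[torusMeasure] w := by
  obtain ⟨w, h1, h2⟩ := exists_velocity_aux ha hF 1 (Or.inr rfl) (-1) (by norm_num) u
  refine ⟨w, fun n => ?_, ?_⟩
  · rw [h1, invLaplaceF]
    push_cast
    ring
  · convert h2 using 1
    unfold velocity₁
    congr 1
    funext n
    push_cast
    ring

theorem exists_velocity₂ {a : Fin 3 → ℝ} (ha : ∀ i, 0 < a i) {F : ℝ} (hF : 0 < F) (u : L2) :
    ∃ w : L2, (∀ n, coeff w n =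
        -(Complex.I * freq a n 0 * ((freqFSq a F n)⁻¹ : ℝ)) * coeff u n) ∧
      velocity₂ a F u =ᵐ[torusMeasure] w := by
  obtain ⟨w, h1, h2⟩ := exists_velocity_aux ha hF 0 (Or.inl rfl) 1 (by norm_num) u
  refine ⟨w, fun n => ?_, ?_⟩
  · rw [h1, invLaplaceF]
    push_cast
    ring
  · convert h2 using 1
    unfold velocity₂
    congr 1
    funext n
    push_cast
    ring

/-- The Fourier coefficients of `div_h (Ω v)`. -/
theorem coeff_flux {a : Fin 3 → ℝ} {F : ℝ} {u w₁ w₂ : L2}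
    (h₁ : ∀ n, coeff w₁ n = Complex.I * freq a n 1 * ((freqFSq a F n)⁻¹ : ℝ) * coeff u n)
    (h₂ : ∀ n, coeff w₂ n = -(Complex.I * freq a n 0 * ((freqFSq a F n)⁻¹ : ℝ)) * coeff u n)
    (n : Fin 3 → ℤ) :
    Complex.I * freq a n 0 * coeff (fun θ => w₁ θ * u θ) n +
      Complex.I * freq a n 1 * coeff (fun θ => w₂ θ * u θ) n = nonlin a F (coeff u) n := by
  have h := ((hasSum_coeff_mul w₁ u n).mul_left (Complex.I * freq a n 0)).add
    ((hasSum_coeff_mul w₂ u n).mul_left (Complex.I * freq a n 1))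
  rw [← h.tsum_eq, nonlin]
  refine tsum_congr fun k => ?_
  rw [h₁, h₂, kernel]
  push_cast
  linear_combination (-(freq a n 1 * freq a k 0 - freq a n 0 * freq a k 1) *
    ((freqFSq a F k : ℂ))⁻¹ * (coeff u k * coeff u (n - k))) * Complex.I_sq

/-- The real exponential `θ ↦ Re (z exp (-i ň · x))`. -/
noncomputable def realExp (z : ℂ) (n : Fin 3 → ℤ) (θ : Torus) : ℝ :=
  (z * UnitAddTorus.mFourier (-n) θ).re

theorem continuous_realExp (z : ℂ) (n : Fin 3 → ℤ) : Continuous (realExp z n) :=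
  Complex.continuous_re.comp (continuous_const.mul (UnitAddTorus.mFourier (-n)).continuous)

theorem abs_realExp_le (z : ℂ) (n : Fin 3 → ℤ) (θ : Torus) : |realExp z n θ| ≤ ‖z‖ := by
  refine (Complex.abs_re_le_norm _).trans ?_
  rw [norm_mul]
  exact mul_le_of_le_one_right (norm_nonneg _) (norm_mFourier_apply_le _ _)

theorem integrable_mul_realExp {u : Torus → ℝ} (hu : Integrable u torusMeasure) (z : ℂ)
    (n : Fin 3 → ℤ) : Integrable (fun θ => u θ * realExp z n θ) torusMeasure :=
  hu.mul_bdd (c := ‖z‖) (continuous_realExp z n).aestronglyMeasurable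
    (Eventually.of_forall fun θ => abs_realExp_le z n θ)

theorem integral_mul_realExp {u : Torus → ℝ} (hu : Integrable u torusMeasure) (z : ℂ)
    (n : Fin 3 → ℤ) :
    ∫ θ, u θ * realExp z n θ ∂torusMeasure = (z * coeff u n).re := by
  have hint : Integrable (fun θ => z * (UnitAddTorus.mFourier (-n) θ * (u θ : ℂ)))
      torusMeasure := by
    refine Integrable.const_mul ?_ z
    exact hu.ofReal.bdd_mul (c := 1)
      (UnitAddTorus.mFourier (-n)).continuous.aestronglyMeasurable
      (Eventually.of_forall fun θ => norm_mFourier_apply_le _ _)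
  rw [coeff, ← integral_const_mul, ← RCLike.re_eq_complex_re, ← integral_re hint]
  congr 1
  funext θ
  rw [realExp, RCLike.re_eq_complex_re, ← mul_assoc, Complex.re_mul_ofReal, mul_comm]

theorem coeff_const_mul (r : ℝ) (u : Torus → ℝ) (n : Fin 3 → ℤ) :
    coeff (fun θ => r * u θ) n = r * coeff u n := by
  rw [coeff, coeff, ← integral_const_mul]
  congr 1
  funext θ
  push_cast
  ring

theorem integral_mFourier_eq_zero {n : Fin 3 → ℤ} (hn : n ≠ 0) :
    ∫ θ, UnitAddTorus.mFourier n θ ∂torusMeasure = 0 := by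
  have h := fourierBasis_repr (fourierBasis n) 0
  rw [HilbertBasis.repr_self, lp.single_apply_ne _ _ _ hn.symm] at h
  rw [h]
  apply integral_congr_ae
  filter_upwards [ContinuousMap.coeFn_toLp (p := 2) (𝕜 := ℂ) torusMeasure
    (UnitAddTorus.mFourier n : C(Torus, ℂ))] with θ hθ
  have h3 : fourierBasis n θ = UnitAddTorus.mFourier n θ := by
    rw [fourierBasis_apply, hθ]
  rw [h3, neg_zero, UnitAddTorus.mFourier_zero, ContinuousMap.one_apply, one_mul]

/-- A real exponential of frequency `n` has no frequencies but `n` and `-n`. -/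
theorem coeff_realExp_eq_zero {z : ℂ} {n m : Fin 3 → ℤ} (h1 : m ≠ n) (h2 : m ≠ -n) :
    coeff (realExp z n) m = 0 := by
  have hi : ∀ k, Integrable (fun θ => UnitAddTorus.mFourier k θ) torusMeasure := fun k =>
    Integrable.of_bound (UnitAddTorus.mFourier k).continuous.aestronglyMeasurable 1
      (Eventually.of_forall fun θ => norm_mFourier_apply_le _ _)
  have hpt : ∀ θ : Torus, UnitAddTorus.mFourier (-m) θ * (realExp z n θ : ℂ) =
      z / 2 * UnitAddTorus.mFourier (-m + -n) θ +
        starRingEnd ℂ z / 2 * UnitAddTorus.mFourier (-m + n) θ := by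
    intro θ
    rw [realExp, Complex.re_eq_add_conj, map_mul, ← UnitAddTorus.mFourier_neg, neg_neg,
      UnitAddTorus.mFourier_add, UnitAddTorus.mFourier_add]
    ring
  simp_rw [coeff, hpt]
  rw [integral_add ((hi _).const_mul _) ((hi _).const_mul _), integral_const_mul,
    integral_const_mul, integral_mFourier_eq_zero, integral_mFourier_eq_zero]
  · simp
  · intro h; exact h1 (neg_add_eq_zero.mp h)
  · intro h; exact h2 (neg_eq_iff_eq_neg.mp (add_neg_eq_zero.mp h))

theorem symbolQG_neg (a : Fin 3 → ℝ) (F ν ν' : ℝ) (n : Fin 3 → ℤ) :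
    symbolQG a F ν ν' (-n) = symbolQG a F ν ν' n := by
  simp [symbolQG, freqHSq_neg, freqFSq_neg, freq_neg]

/-- The dissipation operator acts on a real exponential through its symbol. -/
theorem multiplier_realExp (a : Fin 3 → ℝ) (F ν ν' r : ℝ) (z : ℂ) (n : Fin 3 → ℤ) :
    multiplier (fun m => (symbolQG a F ν ν' m : ℂ)) (fun θ => r * realExp z n θ)
      =ᵐ[torusMeasure] fun θ => symbolQG a F ν ν' n * (r * realExp z n θ) := by
  have hcoef : ∀ m, (symbolQG a F ν ν' m : ℂ) * coeff (fun θ => r * realExp z n θ) m =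
      symbolQG a F ν ν' n * coeff (fun θ => r * realExp z n θ) m := by
    intro m
    by_cases h1 : m = n
    · rw [h1]
    by_cases h2 : m = -n
    · rw [h2, symbolQG_neg]
    rw [coeff_const_mul, coeff_realExp_eq_zero h1 h2]
    ring
  -- the symbol is even, hence constant on the two frequencies that occur
  have hmem : MemLp (fun θ => symbolQG a F ν ν' n * (r * realExp z n θ)) 2 torusMeasure := by
    refine MemLp.of_bound (C := |symbolQG a F ν ν' n| * (|r| * ‖z‖))
      (continuous_const.mul (continuous_const.mul
        (continuous_realExp z n))).aestronglyMeasurable (Eventually.of_forall fun θ => ?_)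
    rw [Real.norm_eq_abs, abs_mul, abs_mul]
    gcongr
    exact abs_realExp_le z n θ
  have hc2 : ∀ m, coeff (hmem.toLp _) m =
      (symbolQG a F ν ν' m : ℂ) * coeff (fun θ => r * realExp z n θ) m := by
    intro m
    rw [coeff_congr hmem.coeFn_toLp, coeff_const_mul, hcoef]
  obtain ⟨w, hw1, hw2⟩ := exists_multiplier (m := fun m => (symbolQG a F ν ν' m : ℂ))
    (u := fun θ => r * realExp z n θ) (fun m => by rw [symbolQG_neg, Complex.conj_ofReal])
    (by
      simp_rw [← hc2]
      exact (hasSum_sq_coeff _).summable)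
  have hw : w = hmem.toLp _ := ext_coeff fun m => by rw [hw1, hc2]
  rw [hw] at hw2
  exact hw2.trans hmem.coeFn_toLp

theorem mFourier_add_single (n : Fin 3 → ℤ) (θ : Torus) (i : Fin 3) (y : UnitAddCircle) :
    UnitAddTorus.mFourier n (θ + Pi.single i y) = UnitAddTorus.mFourier n θ * fourier (n i) y := by
  have h1 : ∀ j, fourier (n j) ((θ + Pi.single i y : Torus) j) =
      fourier (n j) (θ j) * (if j = i then fourier (n i) y else 1) := by
    intro j
    by_cases hj : j = i
    · subst hj
      rw [Pi.add_apply, Pi.single_eq_same, if_pos rfl, fourier_apply, fourier_apply, fourier_apply,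
        smul_add,
        AddCircle.toCircle_add, Circle.coe_mul]
    · rw [Pi.add_apply, Pi.single_eq_of_ne hj, add_zero, if_neg hj, mul_one]
  simp only [UnitAddTorus.mFourier, ContinuousMap.coe_mk]
  rw [Finset.prod_congr rfl fun j _ => h1 j, Finset.prod_mul_distrib, Finset.prod_ite_eq' ]
  simp

theorem pderiv_realExp {a : Fin 3 → ℝ} (ha : ∀ i, 0 < a i) (i : Fin 3) (r : ℝ) (z : ℂ)
    (n : Fin 3 → ℤ) (θ : Torus) :
    pderiv a i (fun θ => r * realExp z n θ) θ =
      r * realExp (-(z * (Complex.I * freq a n i))) n θ := by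
  have hpt : ∀ h : ℝ, r * realExp z n (θ + Pi.single i
      ((h / (2 * Real.pi * a i) : ℝ) : UnitAddCircle)) =
      r * (z * UnitAddTorus.mFourier (-n) θ *
        Complex.exp (-(Complex.I * freq a n i) * h)).re := by
    intro h
    rw [realExp, mFourier_add_single, fourier_coe_apply, ← mul_assoc]
    congr 4
    have h1 : (a i : ℂ) ≠ 0 := by exact_mod_cast (ha i).ne'
    have h2 : (Real.pi : ℂ) ≠ 0 := by exact_mod_cast Real.pi_ne_zero
    simp only [freq, Pi.neg_apply]
    push_cast
    field_simp
  simp only [pderiv]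
  simp_rw [hpt]
  have hd : HasDerivAt (fun h : ℝ => z * UnitAddTorus.mFourier (-n) θ *
      Complex.exp (-(Complex.I * freq a n i) * h))
      (z * UnitAddTorus.mFourier (-n) θ * (-(Complex.I * freq a n i))) 0 := by
    have h1 : HasDerivAt (fun h : ℝ => -(Complex.I * freq a n i) * (h : ℂ))
        (-(Complex.I * freq a n i)) 0 := by
      simpa using (Complex.ofRealCLM.hasDerivAt (x := (0 : ℝ))).const_mul
        (-(Complex.I * freq a n i))
    have h2 := (h1.cexp).const_mul (z * UnitAddTorus.mFourier (-n) θ)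
    simpa using h2
  have hre : HasDerivAt (fun h : ℝ => (z * UnitAddTorus.mFourier (-n) θ *
      Complex.exp (-(Complex.I * freq a n i) * h)).re)
      (z * UnitAddTorus.mFourier (-n) θ * (-(Complex.I * freq a n i))).re 0 :=
    Complex.reCLM.hasFDerivAt.comp_hasDerivAt _ hd
  rw [(hre.const_mul r).deriv, realExp]
  congr 2
  ring

theorem isTestFunction_realExp {χ : ℝ → ℝ} (hχ : ContDiff ℝ ((⊤ : ℕ∞) : WithTop ℕ∞) χ)
    (hs : ∃ T, ∀ t, T ≤ t → χ t = 0) (z : ℂ) (n : Fin 3 → ℤ) :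
    IsTestFunction fun t θ => χ t * realExp z n θ := by
  constructor
  · have hm : ContDiff ℝ ((⊤ : ℕ∞) : WithTop ℕ∞) fun p : ℝ × (Fin 3 → ℝ) =>
        UnitAddTorus.mFourier (-n) fun i => ((p.2 i : ℝ) : UnitAddCircle) := by
      simp only [UnitAddTorus.mFourier, ContinuousMap.coe_mk, fourier_coe_apply]
      apply contDiff_prod
      intro i _
      refine ContDiff.cexp (ContDiff.div_const (contDiff_const.mul ?_) _)
      exact Complex.ofRealCLM.contDiff.comp ((contDiff_apply ℝ ℝ i).comp contDiff_snd)
    exact (hχ.comp contDiff_fst).mul (Complex.reCLM.contDiff.comp (contDiff_const.mul hm))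
  · obtain ⟨T, hT⟩ := hs
    exact ⟨T, fun t ht θ => by simp [hT t ht]⟩

/-- The space integral in the weak formulation, for a test function `χ(t) Re (z exp (-i ň · x))`. -/
theorem integral_test_realExp {a : Fin 3 → ℝ} (ha : ∀ i, 0 < a i) {F : ℝ} (hF : 0 < F) (ν ν' : ℝ)
    {χ : ℝ → ℝ} (hχ : Differentiable ℝ χ) (z : ℂ) (n : Fin 3 → ℤ) (u : L2) (t : ℝ) :
    ∫ θ, u θ * (deriv (fun τ => χ τ * realExp z n θ) t
        + velocity₁ a F u θ * pderiv a 0 (fun θ => χ t * realExp z n θ) θ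
        + velocity₂ a F u θ * pderiv a 1 (fun θ => χ t * realExp z n θ) θ
        - multiplier (fun n => (symbolQG a F ν ν' n : ℂ)) (fun θ => χ t * realExp z n θ) θ)
        ∂torusMeasure =
      (z * coeff u n).re * deriv χ t +
        (z * -((symbolQG a F ν ν' n : ℂ) * coeff u n + nonlin a F (coeff u) n)).re * χ t := by
  obtain ⟨w₁, h₁, e₁⟩ := exists_velocity₁ ha hF u
  obtain ⟨w₂, h₂, e₂⟩ := exists_velocity₂ ha hF u
  have hu : Integrable u torusMeasure := (Lp.memLp u).integrable (by norm_num)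
  have hw₁ : Integrable (fun θ => w₁ θ * u θ) torusMeasure :=
    (Lp.memLp w₁).integrable_mul (Lp.memLp u)
  have hw₂ : Integrable (fun θ => w₂ θ * u θ) torusMeasure :=
    (Lp.memLp w₂).integrable_mul (Lp.memLp u)
  set z₁ : ℂ := -(z * (Complex.I * freq a n 0)) with hz₁
  set z₂ : ℂ := -(z * (Complex.I * freq a n 1)) with hz₂
  set σ : ℝ := symbolQG a F ν ν' n with hσ
  have hint : ∫ θ, u θ * (deriv (fun τ => χ τ * realExp z n θ) t
        + velocity₁ a F u θ * pderiv a 0 (fun θ => χ t * realExp z n θ) θ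
        + velocity₂ a F u θ * pderiv a 1 (fun θ => χ t * realExp z n θ) θ
        - multiplier (fun n => (symbolQG a F ν ν' n : ℂ)) (fun θ => χ t * realExp z n θ) θ)
        ∂torusMeasure =
      ∫ θ, ((deriv χ t - σ * χ t) * (u θ * realExp z n θ) +
        (χ t * (w₁ θ * u θ * realExp z₁ n θ) + χ t * (w₂ θ * u θ * realExp z₂ n θ)))
        ∂torusMeasure := by
    apply integral_congr_ae
    filter_upwards [e₁, e₂, multiplier_realExp a F ν ν' (χ t) z n] with θ q₁ q₂ q₃
    rw [q₁, q₂, q₃, pderiv_realExp ha, pderiv_realExp ha, deriv_mul_const (hχ t)]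
    ring
  have i₀ := (integrable_mul_realExp hu z n).const_mul (deriv χ t - σ * χ t)
  have i₁ := (integrable_mul_realExp hw₁ z₁ n).const_mul (χ t)
  have i₂ := (integrable_mul_realExp hw₂ z₂ n).const_mul (χ t)
  have i₁₂ : Integrable (fun θ => χ t * (w₁ θ * u θ * realExp z₁ n θ) +
      χ t * (w₂ θ * u θ * realExp z₂ n θ)) torusMeasure := i₁.add i₂
  rw [hint, integral_add i₀ i₁₂, integral_add i₁ i₂, integral_const_mul,
    integral_const_mul, integral_const_mul, integral_mul_realExp hu, integral_mul_realExp hw₁,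
    integral_mul_realExp hw₂, ← coeff_flux h₁ h₂ n]
  have hre : (z * -((σ : ℂ) * coeff u n + (Complex.I * freq a n 0 * coeff (fun θ => w₁ θ * u θ) n +
      Complex.I * freq a n 1 * coeff (fun θ => w₂ θ * u θ) n))).re =
      -(σ * (z * coeff u n).re) + (z₁ * coeff (fun θ => w₁ θ * u θ) n).re +
        (z₂ * coeff (fun θ => w₂ θ * u θ) n).re := by
    rw [← Complex.re_ofReal_mul, ← Complex.neg_re, ← Complex.add_re, ← Complex.add_re]
    congr 1
    rw [hz₁, hz₂]
    ring
  rw [hre]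
  ring

/-! ### From weak solutions to Fourier coefficients -/

/-- The weight `(1 + ň₃²)^{s/2}` of `H^{0,s}`. -/
noncomputable def sobolevWeight (a : Fin 3 → ℝ) (s : ℝ) (n : Fin 3 → ℤ) : ℝ≥0∞ :=
  ENNReal.ofReal ((1 + freq a n 2 ^ 2) ^ (s / 2))

theorem sobolevWeight_zero (a : Fin 3 → ℝ) (n : Fin 3 → ℤ) : sobolevWeight a 0 n = 1 := by
  simp [sobolevWeight]

theorem sobolevWeight_sq (a : Fin 3 → ℝ) (s : ℝ) (n : Fin 3 → ℤ) :
    sobolevWeight a s n ^ 2 = ENNReal.ofReal ((1 + freq a n 2 ^ 2) ^ s) := by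
  rw [sobolevWeight, ← ENNReal.ofReal_pow (by positivity), ← Real.rpow_natCast,
    ← Real.rpow_mul (by positivity)]
  norm_num

theorem sobolevWeight_subadditive (a : Fin 3 → ℝ) {s : ℝ} (hs : 0 < s) (n k : Fin 3 → ℤ) :
    sobolevWeight a s n ≤
      ENNReal.ofReal (4 ^ (s / 2)) * (sobolevWeight a s k + sobolevWeight a s (n - k)) := by
  have h1 : ∀ p q : ℝ, p ^ 2 ≤ q ^ 2 →
      (1 + (p + q) ^ 2) ^ (s / 2) ≤ 4 ^ (s / 2) * (1 + q ^ 2) ^ (s / 2) := by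
    intro p q hpq
    rw [← Real.mul_rpow (by norm_num) (by positivity)]
    apply Real.rpow_le_rpow (by positivity) _ (by positivity)
    nlinarith [sq_nonneg (p - q)]
  have hn : freq a n 2 = freq a k 2 + freq a (n - k) 2 := by rw [freq_sub]; ring
  simp only [sobolevWeight]
  rw [← ENNReal.ofReal_add (by positivity) (by positivity), ← ENNReal.ofReal_mul (by positivity)]
  apply ENNReal.ofReal_le_ofReal
  rw [mul_add, hn]
  set p := freq a k 2
  set q := freq a (n - k) 2
  have hp0 : 0 ≤ (4 : ℝ) ^ (s / 2) * (1 + p ^ 2) ^ (s / 2) := by positivity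
  have hq0 : 0 ≤ (4 : ℝ) ^ (s / 2) * (1 + q ^ 2) ^ (s / 2) := by positivity
  rcases le_total (p ^ 2) (q ^ 2) with h | h
  · linarith [h1 p q h]
  · have := h1 q p h
    rw [add_comm q p] at this
    linarith

theorem normSq_eq_tsum (a : Fin 3 → ℝ) (s : ℝ) (u : L2) :
    normSq a s u = ∑' n, (sobolevWeight a s n * ‖coeff u n‖ₑ) ^ 2 := by
  rw [normSq, sobolevSq]
  refine tsum_congr fun n => ?_
  rw [Real.rpow_zero, one_mul, mul_pow, sobolevWeight_sq, ENNReal.ofReal_mul (by positivity),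
    ENNReal.ofReal_pow (norm_nonneg _), ofReal_norm]

theorem gradNormSq_eq_tsum (a : Fin 3 → ℝ) (s : ℝ) (u : L2) :
    gradNormSq a s u = ∑' n, (sobolevWeight a s n * (hNorm a n * ‖coeff u n‖ₑ)) ^ 2 := by
  rw [gradNormSq, sobolevSq, sobolevSq, ← ENNReal.tsum_add]
  refine tsum_congr fun n => ?_
  rw [mul_pow, mul_pow, sobolevWeight_sq, hNorm_sq, ← ofReal_norm,
    ← ENNReal.ofReal_pow (norm_nonneg _), ← ENNReal.ofReal_mul (freqHSq_nonneg a n),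
    ← ENNReal.ofReal_mul (by positivity), ← ENNReal.ofReal_add (by positivity) (by positivity)]
  congr 1
  simp only [Real.rpow_zero, norm_mul, Complex.norm_I, Complex.norm_real, Real.norm_eq_abs,
    mul_pow, sq_abs, freqHSq]
  ring

theorem tsum_enorm_sq_coeff (u : L2) : ∑' n, ‖coeff u n‖ₑ ^ 2 = ENNReal.ofReal (‖u‖ ^ 2) := by
  have h := hasSum_sq_coeff u
  rw [← h.tsum_eq, ENNReal.ofReal_tsum_of_nonneg (fun n => sq_nonneg _) h.summable]
  refine tsum_congr fun n => ?_
  rw [ENNReal.ofReal_pow (norm_nonneg _), ofReal_norm]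

/-- A square summable family of coefficients with the symmetry of real functions is the family of
Fourier coefficients of a real function of `L²`. -/
theorem exists_coeff_eq {c : (Fin 3 → ℤ) → ℂ} (hs : ∑' n, ‖c n‖ₑ ^ 2 ≠ ⊤)
    (hc : ∀ n, c (-n) = starRingEnd ℂ (c n)) : ∃ u : L2, ∀ n, coeff u n = c n := by
  obtain ⟨u, hu, -⟩ := exists_re_tsum (c := c)
    (Summable.of_enorm (by simpa [enorm_pow] using hs)) hc
  exact ⟨u, hu⟩

/-- The Fourier coefficients of a weak solution agree, at almost all times, with those of a
solution of the equation mode by mode that starts from the initial datum. -/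
theorem IsWeakSolution.exists_modeSolution {a : Fin 3 → ℝ} (ha : ∀ i, 0 < a i) {F ν ν' : ℝ}
    (hF : 0 < F) {Ω₀ : L2} {Ω : ℝ → L2} (h : IsWeakSolution a F ν ν' Ω₀ Ω) :
    ∃ x : ℝ → (Fin 3 → ℤ) → ℂ, IsModeSolution a F ν ν' x ∧ (∀ n, x 0 n = coeff Ω₀ n) ∧
      ∀ᵐ t ∂volume.restrict (Set.Ici (0 : ℝ)), ∀ n, x t n = coeff (Ω t) n := by
  -- a strongly measurable version of the solution
  set v : ℝ → L2 := h.measurable.mk Ω with hv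
  have hvm : StronglyMeasurable v := h.measurable.stronglyMeasurable_mk
  have hae : Ω =ᵐ[volume.restrict (Set.Ici 0)] v := h.measurable.ae_eq_mk
  have hIcc : ∀ T : ℝ, volume.restrict (Set.Icc 0 T) ≤ volume.restrict (Set.Ici (0 : ℝ)) :=
    fun T => Measure.restrict_mono Set.Icc_subset_Ici_self le_rfl
  have haeT : ∀ T : ℝ, ∀ᵐ t ∂volume.restrict (Set.Icc 0 T), Ω t = v t := fun T =>
    ae_mono (hIcc T) hae
  set y : ℝ → (Fin 3 → ℤ) → ℂ := fun t n => coeff (v t) n with hy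
  have hym : ∀ n, Measurable fun t => y t n := fun n =>
    ((continuous_coeff n).comp_stronglyMeasurable hvm).measurable
  have hyb : ∀ T : ℝ, ∃ M : ℝ≥0∞, M ≠ ⊤ ∧
      ∀ᵐ t ∂volume.restrict (Set.Icc 0 T), ∑' n, ‖y t n‖ₑ ^ 2 ≤ M := by
    intro T
    obtain ⟨M, hM⟩ := h.bounded T
    refine ⟨ENNReal.ofReal (M ^ 2), ENNReal.ofReal_ne_top, ?_⟩
    filter_upwards [hM, haeT T] with t h1 h2
    rw [hy, tsum_enorm_sq_coeff, ← h2]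
    gcongr
  have hyg : ∀ T : ℝ, ∫⁻ t in Set.Icc 0 T, ∑' n, (hNorm a n * ‖y t n‖ₑ) ^ 2 ≠ ⊤ := by
    intro T
    have h1 : ∫⁻ t in Set.Icc 0 T, ∑' n, (hNorm a n * ‖y t n‖ₑ) ^ 2 =
        ∫⁻ t in Set.Icc 0 T, gradNormSq a 0 (Ω t) := by
      apply lintegral_congr_ae
      filter_upwards [haeT T] with t ht
      rw [gradNormSq_eq_tsum, ht]
      simp only [sobolevWeight_zero, one_mul, hy]
    rw [h1]
    exact (h.gradient T).ne
  set rhs : (Fin 3 → ℤ) → ℝ → ℂ := fun n t =>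
    (symbolQG a F ν ν' n : ℂ) * y t n + nonlin a F (y t) n with hrhs
  have hyi : ∀ n T, IntegrableOn (fun t => y t n) (Set.Icc 0 T) := by
    intro n T
    obtain ⟨M, hM⟩ := h.bounded T
    refine Measure.integrableOn_of_bounded (M := M) (by simp)
      (hym n).aestronglyMeasurable ?_
    filter_upwards [hM, haeT T] with t h1 h2
    have h3 := (hasSum_sq_coeff (v t)).summable.le_tsum n fun j _ => sq_nonneg _
    rw [(hasSum_sq_coeff (v t)).tsum_eq, ← congrArg norm h2] at h3
    exact ((sq_le_sq₀ (norm_nonneg _) (norm_nonneg _)).mp h3).trans h1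
  have hri : ∀ n T, IntegrableOn (rhs n) (Set.Icc 0 T) := by
    intro n T
    obtain ⟨M, hM, hb⟩ := hyb T
    exact ((hyi n T).const_mul _).add (integrable_nonlin ha hF hym hM hb (hyg T) n)
  have hrii : ∀ n t, 0 ≤ t → IntervalIntegrable (rhs n) volume 0 t := fun n t ht => by
    rw [intervalIntegrable_iff_integrableOn_Icc_of_le ht]
    exact hri n t
  have hweak : ∀ (n : Fin 3 → ℤ) (z : ℂ), ∀ᵐ t ∂volume.restrict (Set.Ici (0 : ℝ)),
      (z * y t n).re = (z * (coeff Ω₀ n - ∫ τ in 0..t, rhs n τ)).re := by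
    intro n z
    have h1 := ae_eq_add_integral_of_weak (f := fun t => (z * y t n).re)
      (g := fun t => (z * -rhs n t).re) (f₀ := (z * coeff Ω₀ n).re)
      (fun T => ((hyi n T).const_mul z).re) (fun T => ((hri n T).neg.const_mul z).re) ?_
    · filter_upwards [h1, ae_restrict_mem measurableSet_Ici] with t ht ht0
      rw [ht, mul_sub, Complex.sub_re, sub_eq_add_neg]
      congr 1
      have h2 : IntervalIntegrable (fun τ => z * -rhs n τ) volume 0 t :=
        ((hrii n t ht0).neg).const_mul z
      have h3 := Complex.reCLM.intervalIntegral_comp_comm h2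
      simp only [Complex.reCLM_apply] at h3
      rw [h3, intervalIntegral.integral_const_mul, intervalIntegral.integral_neg, mul_neg,
        Complex.neg_re]
    · intro χ hχ hs
      have h2 := h.equation _ (isTestFunction_realExp hχ hs z n)
      have hχd : Differentiable ℝ χ := hχ.differentiable (by simp)
      simp only [integral_test_realExp ha hF ν ν' hχd] at h2
      have h3 : ∫ θ, Ω₀ θ * (χ 0 * realExp z n θ) ∂torusMeasure = (z * coeff Ω₀ n).re * χ 0 := by
        rw [← integral_mul_realExp ((Lp.memLp Ω₀).integrable (by norm_num)),
          ← integral_mul_const]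
        congr 1
        funext θ
        ring
      rw [h3] at h2
      refine Eq.trans ?_ h2
      congr 1
      apply integral_congr_ae
      filter_upwards [hae] with t ht
      rw [ht]
  have hode : ∀ᵐ t ∂volume.restrict (Set.Ici (0 : ℝ)), ∀ n,
      y t n = coeff Ω₀ n - ∫ τ in 0..t, rhs n τ := by
    rw [ae_all_iff]
    intro n
    filter_upwards [hweak n 1, hweak n (-Complex.I)] with t h1 h2
    apply Complex.ext
    · simpa using h1
    · simpa using h2
  set x : ℝ → (Fin 3 → ℤ) → ℂ := fun t n =>
    coeff Ω₀ n - ∫ τ in 0..t, (Set.Ici (0 : ℝ)).indicator (rhs n) τ with hx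
  have hx0 : ∀ n, x 0 n = coeff Ω₀ n := fun n => by simp [hx]
  have hxt : ∀ n t, 0 ≤ t → x t n = coeff Ω₀ n - ∫ τ in 0..t, rhs n τ := by
    intro n t ht
    simp only [hx]
    congr 1
    apply intervalIntegral.integral_congr
    intro τ hτ
    rw [Set.uIcc_of_le ht] at hτ
    exact Set.indicator_of_mem hτ.1 _
  have hxy : ∀ᵐ t ∂volume.restrict (Set.Ici (0 : ℝ)), x t = y t := by
    filter_upwards [hode, ae_restrict_mem measurableSet_Ici] with t h1 h2
    funext n
    rw [h1 n, hxt n t h2]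
  have hxyT : ∀ T : ℝ, ∀ᵐ t ∂volume.restrict (Set.Icc 0 T), x t = y t := fun T =>
    ae_mono (hIcc T) hxy
  have hxc : ∀ n, Continuous fun t => x t n := by
    intro n
    refine continuous_const.sub (intervalIntegral.continuous_primitive (fun p q => ?_) 0)
    rw [intervalIntegrable_iff, integrableOn_indicator_iff measurableSet_Ici]
    exact (hri n (max p q)).mono_set fun t ht => ⟨ht.1, ht.2.2⟩
  refine ⟨x, ⟨hxc, ?_, ?_, ?_, ?_⟩, hx0, ?_⟩
  · intro t ht n
    have h1 : (fun s => x s (-n)) =ᵐ[volume.restrict (Set.Icc 0 (t + 1))]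
        fun s => starRingEnd ℂ (x s n) := by
      filter_upwards [hxyT (t + 1)] with s hs
      rw [hs]
      exact coeff_neg _ n
    exact Measure.eqOn_Icc_of_ae_eq volume (by linarith) h1 (hxc (-n)).continuousOn
      (Complex.continuous_conj.comp (hxc n)).continuousOn ⟨ht, by linarith⟩
  · intro T
    obtain ⟨M, hM, hb⟩ := hyb (|T| + 1)
    refine ⟨M, hM, fun t ht => ennreal_tsum_le_of_sum_le fun S => ?_⟩
    -- the bound holds almost everywhere, and both sides of `φ = min φ M` are continuous
    have hφ : Continuous fun s => ∑ n ∈ S, ‖x s n‖ₑ ^ 2 :=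
      continuous_finsetSum S fun n _ => ENNReal.continuous_pow 2 |>.comp (hxc n).enorm
    have h1 : (fun s => ∑ n ∈ S, ‖x s n‖ₑ ^ 2) =ᵐ[volume.restrict (Set.Icc 0 (|T| + 1))]
        fun s => min (∑ n ∈ S, ‖x s n‖ₑ ^ 2) M := by
      filter_upwards [hxyT (|T| + 1), hb] with s hs hs2
      rw [hs]
      exact (min_eq_left ((ENNReal.sum_le_tsum S).trans hs2)).symm
    have h2 := Measure.eqOn_Icc_of_ae_eq volume (by positivity) h1 hφ.continuousOn
      (hφ.min continuous_const).continuousOn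
      (⟨ht.1, ht.2.trans ((le_abs_self T).trans (by linarith))⟩ : t ∈ Set.Icc 0 (|T| + 1))
    exact min_eq_left_iff.mp h2.symm
  · intro T
    have h1 : ∫⁻ t in Set.Icc 0 T, ∑' n, (hNorm a n * ‖x t n‖ₑ) ^ 2 =
        ∫⁻ t in Set.Icc 0 T, ∑' n, (hNorm a n * ‖y t n‖ₑ) ^ 2 := by
      apply lintegral_congr_ae
      filter_upwards [hxyT T] with t ht
      rw [ht]
    rw [h1]
    exact hyg T
  · intro n t ht
    rw [hx0, hxt n t ht]
    congr 1
    rw [intervalIntegral.integral_of_le ht, intervalIntegral.integral_of_le ht,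
      ← integral_Icc_eq_integral_Ioc, ← integral_Icc_eq_integral_Ioc]
    apply integral_congr_ae
    filter_upwards [hxyT t] with τ hτ
    rw [hτ]
  · filter_upwards [hxy, hae] with t h1 h2
    intro n
    rw [h1, h2]

/-! ### The estimate in `H^{0,s}` for weak solutions -/

theorem setLIntegral_Ici_le {f : ℝ → ℝ≥0∞} {b : ℝ≥0∞}
    (h : ∀ t : ℝ, 0 ≤ t → ∫⁻ τ in Set.Icc 0 t, f τ ≤ b) : ∫⁻ τ in Set.Ici (0 : ℝ), f τ ≤ b := by
  have hU : Set.Ici (0 : ℝ) = ⋃ k : ℕ, Set.Icc (0 : ℝ) k := by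
    ext t
    simp only [Set.mem_Ici, Set.mem_iUnion, Set.mem_Icc, exists_and_left]
    exact ⟨fun ht => ⟨ht, exists_nat_ge t⟩, fun ht => ht.1⟩
  rw [hU, setLIntegral_iUnion_of_directed]
  · exact iSup_le fun k => h k (Nat.cast_nonneg k)
  · exact (monotone_nat_of_le_succ fun k => Set.Icc_subset_Icc le_rfl (by simp)).directed_le

end QG

theorem mainTheorem6 (ν ν' : ℝ) (hν : 0 < ν) (hν' : 0 < ν') :
    ∃ c : ℝ, 0 < c ∧
      ∀ (a : Fin 3 → ℝ) (_ : ∀ i, 0 < a i) (F : ℝ) (_ : 0 < F) (s : ℝ) (_ : 0 < s),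
        ∃ C : ℝ, 0 < C ∧
          ∀ (Ω₀ : QG.L2) (Ω : ℝ → QG.L2),
            QG.normSq a s Ω₀ < ⊤ → QG.IsWeakSolution a F ν ν' Ω₀ Ω →
            ∃ Ω' : ℝ → QG.L2,
              (∀ᵐ t ∂(volume.restrict (Set.Ici (0 : ℝ))), Ω' t = Ω t) ∧ Ω' 0 = Ω₀ ∧
              QG.ContinuousInH a s Ω' ∧
              ∫⁻ t in Set.Ici (0 : ℝ), QG.gradNormSq a s (Ω' t) < ⊤ ∧
              ∀ t : ℝ, 0 ≤ t →
                QG.normSq a s (Ω' t)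
                    + ENNReal.ofReal c * ∫⁻ τ in Set.Icc 0 t, QG.gradNormSq a s (Ω' τ) ≤
                  ENNReal.ofReal C * QG.normSq a s Ω₀ *
                    ENNReal.ofReal (Real.exp (2 * C / c *
                      (1 + QG.l2NormSq a Ω₀) * QG.l2NormSq a Ω₀)) := by
  have hc : 0 < min ν ν' := lt_min hν hν'
  refine ⟨min ν ν', hc, fun a ha F hF s hs => ?_⟩
  obtain ⟨K, hK, hbound⟩ := QG.exists_weight_bound (F := F) ha hF hν hν'
  set c := min ν ν' with hcdef
  set Cs : ℝ := 4 ^ (s / 2) with hCs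
  have hCs1 : 1 ≤ Cs := Real.one_le_rpow (by norm_num) (by positivity)
  set V : ℝ := ∏ i, 2 * Real.pi * a i with hV
  have hVpos : 0 < V := Finset.prod_pos fun i _ => by
    have := ha i
    positivity
  -- the volume enters through the normalisation of the `L²` norm
  refine ⟨max 1 (c * (K * Cs ^ 2) / (2 * V)), by positivity, fun Ω₀ Ω h0 hΩ => ?_⟩
  set C := max 1 (c * (K * Cs ^ 2) / (2 * V)) with hC
  obtain ⟨x, hx, hx0, hxΩ⟩ := hΩ.exists_modeSolution ha hF
  have hex : ∀ t, ∃ u : QG.L2, 0 ≤ t → ∀ n, QG.coeff u n = x t n := by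
    intro t
    by_cases ht : 0 ≤ t
    · obtain ⟨M, hM, hb⟩ := hx.bounded t
      obtain ⟨u, hu⟩ := QG.exists_coeff_eq (ne_top_of_le_ne_top hM (hb t ⟨ht, le_rfl⟩))
        (hx.hermitian t ht)
      exact ⟨u, fun _ => hu⟩
    · exact ⟨0, fun h => absurd h ht⟩
  choose Ω' hΩ' using hex
  have hfin : ∀ n, QG.sobolevWeight a s n ≠ ⊤ := fun n => ENNReal.ofReal_ne_top
  have hnorm : ∀ t, 0 ≤ t →
      QG.normSq a s (Ω' t) = ∑' n, (QG.sobolevWeight a s n * ‖x t n‖ₑ) ^ 2 := fun t ht => by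
    simp only [QG.normSq_eq_tsum, hΩ' t ht]
  have hgrad : ∀ t, ∫⁻ τ in Set.Icc 0 t, QG.gradNormSq a s (Ω' τ) =
      ∫⁻ τ in Set.Icc 0 t,
        ∑' n, (QG.sobolevWeight a s n * (QG.hNorm a n * ‖x τ n‖ₑ)) ^ 2 := fun t => by
    refine setLIntegral_congr_fun measurableSet_Icc fun τ hτ => ?_
    simp only [QG.gradNormSq_eq_tsum, hΩ' τ hτ.1]
  have hnorm0 : QG.normSq a s Ω₀ = ∑' n, (QG.sobolevWeight a s n * ‖x 0 n‖ₑ) ^ 2 := by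
    simp only [QG.normSq_eq_tsum, hx0]
  have he : (∑' n, ‖x 0 n‖ₑ ^ 2).toReal = ‖Ω₀‖ ^ 2 := by
    simp only [hx0]
    rw [QG.tsum_enorm_sq_coeff, ENNReal.toReal_ofReal (sq_nonneg _)]
  have hexp : K * Cs ^ 2 * ‖Ω₀‖ ^ 2 ≤
      2 * C / c * (1 + QG.l2NormSq a Ω₀) * QG.l2NormSq a Ω₀ := by
    have hl : QG.l2NormSq a Ω₀ = V * ‖Ω₀‖ ^ 2 := rfl
    have hCV : K * Cs ^ 2 ≤ 2 * C / c * V := by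
      have h1 : c * (K * Cs ^ 2) / (2 * V) ≤ C := le_max_right _ _
      rw [div_le_iff₀ (by positivity)] at h1
      rw [div_mul_eq_mul_div, le_div_iff₀ hc]
      linarith
    have hl0 : 0 ≤ QG.l2NormSq a Ω₀ := by rw [hl]; positivity
    have hCpos : 0 < C := by positivity
    calc K * Cs ^ 2 * ‖Ω₀‖ ^ 2 ≤ 2 * C / c * V * ‖Ω₀‖ ^ 2 := by gcongr
      _ = 2 * C / c * 1 * QG.l2NormSq a Ω₀ := by rw [hl]; ring
      _ ≤ _ := by gcongr; linarith
  have hmain : ∀ t : ℝ, 0 ≤ t →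
      QG.normSq a s (Ω' t)
          + ENNReal.ofReal c * ∫⁻ τ in Set.Icc 0 t, QG.gradNormSq a s (Ω' τ) ≤
        ENNReal.ofReal C * QG.normSq a s Ω₀ *
          ENNReal.ofReal (Real.exp (2 * C / c *
            (1 + QG.l2NormSq a Ω₀) * QG.l2NormSq a Ω₀)) := by
    intro t ht
    rw [hnorm t ht, hgrad t, hnorm0]
    refine (hbound (QG.sobolevWeight a s) Cs hCs1 hfin
      (QG.sobolevWeight_subadditive a hs) x hx t ht).trans ?_
    rw [he]
    gcongr
    exact le_mul_of_one_le_left' (ENNReal.one_le_ofReal.mpr (le_max_left _ _))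
  have hRfin : ENNReal.ofReal C * QG.normSq a s Ω₀ *
      ENNReal.ofReal (Real.exp (2 * C / c *
        (1 + QG.l2NormSq a Ω₀) * QG.l2NormSq a Ω₀)) < ⊤ :=
    ENNReal.mul_lt_top (ENNReal.mul_lt_top ENNReal.ofReal_lt_top h0) ENNReal.ofReal_lt_top
  refine ⟨Ω', ?_, ?_, ⟨fun t ht => le_self_add.trans_lt ((hmain t ht).trans_lt hRfin), ?_⟩, ?_,
    hmain⟩
  · filter_upwards [hxΩ, ae_restrict_mem measurableSet_Ici] with t h1 h2
    exact QG.ext_coeff fun n => by rw [hΩ' t h2, h1]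
  · exact QG.ext_coeff fun n => by rw [hΩ' 0 le_rfl, hx0]
  · intro t₀ ht₀
    refine (hx.tendsto_weighted ha hF hν hν' hCs1 hfin (QG.sobolevWeight_subadditive a hs)
      (hnorm0 ▸ h0.ne) ht₀).congr' ?_
    filter_upwards [self_mem_nhdsWithin] with t ht
    simp only [QG.normSq_eq_tsum, QG.coeff_sub, hΩ' t ht, hΩ' t₀ ht₀]
  · have hle : ∫⁻ t in Set.Ici (0 : ℝ), QG.gradNormSq a s (Ω' t) ≤
        (ENNReal.ofReal c)⁻¹ * (ENNReal.ofReal C * QG.normSq a s Ω₀ *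
          ENNReal.ofReal (Real.exp (2 * C / c *
            (1 + QG.l2NormSq a Ω₀) * QG.l2NormSq a Ω₀))) := by
      refine QG.setLIntegral_Ici_le fun t ht => ?_
      rw [mul_comm, ← div_eq_mul_inv,
        ENNReal.le_div_iff_mul_le (Or.inl (by simpa using hc)) (Or.inl ENNReal.ofReal_ne_top),
        mul_comm]
      exact le_add_self.trans (hmain t ht)
    exact hle.trans_lt (ENNReal.mul_lt_top
      (ENNReal.inv_lt_top.mpr (ENNReal.ofReal_pos.mpr hc)) hRfin)
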